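/- Graphs are finite, undirected and simple. For a vertex $x$ of a graph $G=(V,E)$ let $N(x)$ be the set of neighbours of $x$ and $N_2(x)$ the set of vertices at distance exactly $2$ from $x$. A set $S\subseteq V$ dominates $T\subseteq V$ if every vertex of $T$ belongs to $S$ or has a neighbour in $S$. The vertex $x$ is called extendable if no independent set $S\subseteq N_2(x)$ dominates $N(x)$. Theorem. The following problem can be solved in $O(|V|(|V|+|E|))$ time. Input: a graph $G=(V,E)$, given by adjacency lists, that contains no (not necessarily induced) subgraph isomorphic to the cycle $C_6$ or to the cycle $C_7$, and a vertex $x\in V$. Question: is $x$ extendable? That is, there are a fixed program for a random access machine (finitely many registers and arrays of natural numbers; each assignment, increment, decrement, array access and comparison takes one time step) and a constant $C$ such that, on every such input, the program halts after at most $C\,|V|(|V|+|E|)$ steps and answers correctly whether $x$ is extendable. -/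

import Mathlib

/-! ## Extendable vertices -/

namespace SimpleGraph

variable {V : Type*} (G : SimpleGraph V)

/-- `N_i(v)`: the vertices at distance exactly `i` from `v`
(the extended distance is `⊤` between different components). -/
def nbhd (i : ℕ) (v : V) : Set V := {u | G.edist v u = i}

/-- The closed neighbourhood `N[S]` of a set of vertices. -/
def closedNbhd (S : Set V) : Set V := {u | u ∈ S ∨ ∃ s ∈ S, G.Adj s u}

/-- `S` dominates `T` if `T ⊆ N[S]`. -/
def Dominates (S T : Set V) : Prop := T ⊆ G.closedNbhd S

/-- `x` is extendable if no independent set contained in `N_2(x)` dominates `N(x)`. -/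
def IsExtendable (x : V) : Prop :=
  ¬ ∃ S : Set V, S ⊆ G.nbhd 2 x ∧ G.IsIndepSet S ∧ G.Dominates S (G.neighborSet x)

end SimpleGraph

/-! ## A random access machine with a step count

Programs work on natural-number registers and on arrays of natural numbers that can be addressed
by the content of a register. A program is a finite piece of syntax, so it mentions only finitely
many registers and finitely many arrays. The only arithmetic is adding or subtracting one;
in particular numbers grow by at most one per step, so that charging one unit per operation
cannot hide work in long numbers. -/

namespace RAM

/-- A memory configuration: register `i` holds `reg i`, cell `j` of array `k` holds `arr k j`. -/
structure State where
  reg : ℕ → ℕ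
  arr : ℕ → ℕ → ℕ

/-- Write a register. -/
def State.setReg (s : State) (i v : ℕ) : State :=
  { s with reg := Function.update s.reg i v }

/-- Write an array cell. -/
def State.setArr (s : State) (k j v : ℕ) : State :=
  { s with arr := Function.update s.arr k (Function.update (s.arr k) j v) }

/-- Elementary operations; each of them takes one time step. -/
inductive Op where
  /-- `r_i := c` for a constant `c` -/
  | const (i c : ℕ)
  /-- `r_i := r_j` -/
  | copy (i j : ℕ)
  /-- `r_i := r_i + 1` -/
  | inc (i : ℕ)
  /-- `r_i := r_i - 1`, truncated at zero -/
  | dec (i : ℕ)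
  /-- `r_i := A_k[r_j]` -/
  | load (i k j : ℕ)
  /-- `A_k[r_i] := r_j` -/
  | store (k i j : ℕ)

/-- The effect of an elementary operation. -/
def Op.apply : Op → State → State
  | .const i c, s => s.setReg i c
  | .copy i j, s => s.setReg i (s.reg j)
  | .inc i, s => s.setReg i (s.reg i + 1)
  | .dec i, s => s.setReg i (s.reg i - 1)
  | .load i k j, s => s.setReg i (s.arr k (s.reg j))
  | .store k i j, s => s.setArr k (s.reg i) (s.reg j)

/-- Tests; evaluating a test takes one time step. -/
inductive Test where
  /-- `r_i < r_j` -/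
  | lt (i j : ℕ)
  /-- `r_i = r_j` -/
  | eq (i j : ℕ)

/-- The truth value of a test. -/
def Test.Holds : Test → State → Prop
  | .lt i j, s => s.reg i < s.reg j
  | .eq i j, s => s.reg i = s.reg j

/-- Structured programs: operations, sequencing, branching and while-loops. -/
inductive Prog where
  | op (o : Op)
  | seq (p q : Prog)
  | branch (b : Test) (p q : Prog)
  | loop (b : Test) (p : Prog)

/-- `Exec p s t s'`: started in `s`, the program `p` halts after exactly `t` time steps, in the
configuration `s'`. (The machine is deterministic: `p` and `s` determine `t` and `s'`.) -/
inductive Exec : Prog → State → ℕ → State → Prop where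
  | op (o : Op) (s : State) : Exec (.op o) s 1 (o.apply s)
  | seq {p q : Prog} {s s₁ s₂ : State} {t₁ t₂ : ℕ} :
      Exec p s t₁ s₁ → Exec q s₁ t₂ s₂ → Exec (.seq p q) s (t₁ + t₂) s₂
  | branchTrue {b : Test} {p q : Prog} {s s' : State} {t : ℕ} :
      b.Holds s → Exec p s t s' → Exec (.branch b p q) s (t + 1) s'
  | branchFalse {b : Test} {p q : Prog} {s s' : State} {t : ℕ} :
      ¬ b.Holds s → Exec q s t s' → Exec (.branch b p q) s (t + 1) s'
  | loopStep {b : Test} {p : Prog} {s s₁ s₂ : State} {t₁ t₂ : ℕ} :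
      b.Holds s → Exec p s t₁ s₁ → Exec (.loop b p) s₁ t₂ s₂ →
      Exec (.loop b p) s (t₁ + t₂ + 1) s₂
  | loopExit {b : Test} {p : Prog} {s : State} :
      ¬ b.Holds s → Exec (.loop b p) s 1 s

/-- `s` is an initial configuration for the input consisting of a graph `G` on the vertices
`0, …, n - 1`, given by adjacency lists, and a vertex `x`. Register `0` holds `n` and register `1`
holds `x`. Array `1` is the concatenation of the adjacency lists of `0, 1, …, n - 1`, and array `0`
holds the borders between them: the neighbours of `v` stand, once each and in an arbitrary order,
in the cells of array `1` whose index lies in `[arr 0 v, arr 0 (v + 1))`.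
Everything else is zero. -/
structure IsInput {n : ℕ} (G : SimpleGraph (Fin n)) (x : Fin n) (s : State) : Prop where
  reg_zero : s.reg 0 = n
  reg_one : s.reg 1 = x
  reg_rest : ∀ i, 2 ≤ i → s.reg i = 0
  border_zero : s.arr 0 0 = 0
  border_mono : ∀ v : Fin n, s.arr 0 v ≤ s.arr 0 ((v : ℕ) + 1)
  border_rest : ∀ j, n < j → s.arr 0 j = 0
  nbrs : ∀ v : Fin n, Set.BijOn (s.arr 1) (Set.Ico (s.arr 0 v) (s.arr 0 ((v : ℕ) + 1)))
    ((fun w : Fin n => (w : ℕ)) '' G.neighborSet v)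
  nbrs_rest : ∀ j, s.arr 0 n ≤ j → s.arr 1 j = 0
  arr_rest : ∀ k, 2 ≤ k → ∀ j, s.arr k j = 0

end RAM

/-! ### Short cycles through `x` and the pruning of its second neighbourhood. -/

namespace SimpleGraph

variable {V : Type*} {G : SimpleGraph V}

/-! Not being extendable means that an independent `S ⊆ N_2(x)` dominates `N(x)`. The algorithm
shrinks a set `B` of live candidates, initially `N_2(x)`, by deletions that never destroy
solvability, until solvability can be read off.

Pruning: if `c ∈ B` has two neighbours `b`, `p` in `B`, excluding `C_6` gives `b` and `p` the same
single neighbour in `N(x)`, and excluding `C_7` allows `p` to replace `b` whenever `b` is needed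
(`Solvable.diff_singleton`). One pass over the arcs makes `G` a matching on `B`, so choosing `S`
resembles 2-SAT: partners exclude each other, and each `a ∈ N(x)` is a clause listing its live
neighbours.

Propagation: if `a` has a single live neighbour, the partner of that neighbour is deleted. If `a`
and `c` have live neighbours `{u, v}` and `{u, w}` with `v`, `w` adjacent, then `u` is forced and
its partner is deleted. In the case needed for completeness `w` has `c` as its only neighbour in
`N(x)`, so one stored neighbour per candidate suffices and an arc costs constant time.

Completeness (`solvable_of_closed`): when neither rule applies and every clause is nonempty, take a
maximal autark partial choice `T`. Among the clauses not satisfied by `T`, maximality and the two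
cycle conditions show that no candidate is shared. These clauses have at least two candidates each,
so Hall's theorem picks candidates from distinct matching classes; this choice extends `T`, a
contradiction unless all clauses were satisfied.

Running time: every round of propagation except the last deletes a vertex, and a round is linear in
`n` plus the number of arcs. -/

theorem Free.false_of_cycle {k : ℕ} (h : (cycleGraph (k + 2)).Free G) (f : Fin (k + 2) → V)
    (hf : Function.Injective f) (hadj : ∀ i, G.Adj (f i) (f (i + 1))) : False := by
  refine h ⟨⟨⟨f, ?_⟩, hf⟩⟩
  intro i j hij
  rw [cycleGraph_adj] at hij
  rcases hij with hij | hij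
  · rw [sub_eq_iff_eq_add.1 hij, add_comm]; exact (hadj j).symm
  · rw [sub_eq_iff_eq_add.1 hij, add_comm]; exact hadj i

theorem Free.no_hexagon (h : (cycleGraph 6).Free G) {x a b c d e : V}
    (hn : [x, a, b, c, d, e].Nodup) (h₁ : G.Adj x a) (h₂ : G.Adj a b) (h₃ : G.Adj b c)
    (h₄ : G.Adj c d) (h₅ : G.Adj d e) (h₆ : G.Adj x e) : False := by
  refine Free.false_of_cycle (k := 4) h [x, a, b, c, d, e].get
    (List.nodup_iff_injective_get.1 hn) ?_
  intro i
  fin_cases i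
  exacts [h₁, h₂, h₃, h₄, h₅, h₆.symm]

theorem Free.no_heptagon (h : (cycleGraph 7).Free G) {x a b c d e f : V}
    (hn : [x, a, b, c, d, e, f].Nodup) (h₁ : G.Adj x a) (h₂ : G.Adj a b) (h₃ : G.Adj b c)
    (h₄ : G.Adj c d) (h₅ : G.Adj d e) (h₆ : G.Adj e f) (h₇ : G.Adj x f) : False := by
  refine Free.false_of_cycle (k := 5) h [x, a, b, c, d, e, f].get
    (List.nodup_iff_injective_get.1 hn) ?_
  intro i
  fin_cases i
  exacts [h₁, h₂, h₃, h₄, h₅, h₆, h₇.symm]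

theorem mem_nbhd_two {x u : V} :
    u ∈ G.nbhd 2 x ↔ u ≠ x ∧ ¬ G.Adj x u ∧ ∃ a, G.Adj x a ∧ G.Adj a u := by
  have key : G.edist x u = 2 → u ≠ x ∧ ¬ G.Adj x u := by
    intro h
    refine ⟨?_, ?_⟩
    · rintro rfl
      simp at h
    · intro hA
      rw [edist_eq_one_iff_adj.2 hA] at h
      norm_num at h
  constructor
  · intro h
    have h : G.edist x u = 2 := h
    refine ⟨(key h).1, (key h).2, ?_⟩
    have hr : G.Reachable x u := by
      rw [← edist_ne_top_iff_reachable, h]; exact ENat.natCast_ne_top 2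
    obtain ⟨p, hp⟩ := hr.exists_walk_length_eq_edist
    rw [h] at hp
    have hp : p.length = 2 := by exact_mod_cast hp
    match p, hp with
    | .cons h₁ (.cons h₂ .nil), _ => exact ⟨_, h₁, h₂⟩
  · rintro ⟨hne, hna, a, h₁, h₂⟩
    change G.edist x u = 2
    have hle : G.edist x u ≤ 2 := by
      simpa using edist_le (Walk.cons h₁ (Walk.cons h₂ Walk.nil))
    refine le_antisymm hle ?_
    by_contra hlt
    rw [not_le] at hlt
    have h1 : G.edist x u ≤ 1 := by
      refine Order.le_of_lt_add_one ?_
      rwa [one_add_one_eq_two]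
    rcases eq_or_lt_of_le h1 with h | h
    · exact hna (edist_eq_one_iff_adj.1 h)
    · rw [Order.lt_one_iff, edist_eq_zero_iff] at h
      exact hne h.symm

/-- Some independent subset of `B` dominates the neighbours of `x` from outside. -/
def Solvable (G : SimpleGraph V) (x : V) (B : Set V) : Prop :=
  ∃ S ⊆ B, G.IsIndepSet S ∧ ∀ a, G.Adj x a → ∃ s ∈ S, G.Adj a s

theorem Solvable.mono {x : V} {B C : Set V} (h : G.Solvable x B) (hBC : B ⊆ C) :
    G.Solvable x C := by
  obtain ⟨S, hS, h⟩ := h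
  exact ⟨S, hS.trans hBC, h⟩

theorem not_isExtendable_iff {x : V} : ¬ G.IsExtendable x ↔ G.Solvable x (G.nbhd 2 x) := by
  unfold IsExtendable Solvable
  rw [not_not]
  refine exists_congr fun S => and_congr_right fun hS => and_congr_right fun _ => ?_
  constructor
  · intro h a ha
    rcases h ha with h | ⟨s, hs, h⟩
    · exact absurd ha (mem_nbhd_two.1 (hS h)).2.1
    · exact ⟨s, hs, h.symm⟩
  · intro h a ha
    obtain ⟨s, hs, h⟩ := h a ha
    exact Or.inr ⟨s, hs, h.symm⟩

/-- In this lemma and the next three, distinct ends of the path would close up through `x` to a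
forbidden cycle. They differ in which inner vertices lie in `N(x)` and which in `N_2(x)`. -/
theorem eq_of_path_three (h6 : (cycleGraph 6).Free G) {x a b c d e : V}
    (hb : b ∈ G.nbhd 2 x) (hc : c ∈ G.nbhd 2 x)
    (hd : d ∈ G.nbhd 2 x) (hbc : G.Adj b c) (hcd : G.Adj c d) (hbd : b ≠ d)
    (ha : G.Adj x a) (he : G.Adj x e) (hab : G.Adj a b) (hde : G.Adj d e) : a = e := by
  rw [mem_nbhd_two] at hb hc hd
  by_contra hae
  refine h6.no_hexagon (x := x) ?_ ha hab hbc hcd hde he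
  have := ha.ne; have := he.ne; have := hab.ne; have := hbc.ne; have := hcd.ne; have := hde.ne
  simp only [List.nodup_cons, List.mem_cons, List.not_mem_nil, List.nodup_nil]
  grind

theorem eq_of_path_four (h7 : (cycleGraph 7).Free G) {x a b c d e f : V}
    (hb : b ∈ G.nbhd 2 x) (hc : c ∈ G.nbhd 2 x)
    (hd : d ∈ G.nbhd 2 x) (he : e ∈ G.nbhd 2 x) (hbc : G.Adj b c) (hcd : G.Adj c d)
    (hde : G.Adj d e) (hbd : b ≠ d) (hbe : b ≠ e) (hce : c ≠ e)
    (ha : G.Adj x a) (hf : G.Adj x f) (hab : G.Adj a b) (hef : G.Adj e f) : a = f := by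
  rw [mem_nbhd_two] at hb hc hd he
  by_contra haf
  refine h7.no_heptagon (x := x) ?_ ha hab hbc hcd hde hef hf
  have := ha.ne; have := hf.ne; have := hab.ne; have := hbc.ne; have := hcd.ne
  have := hde.ne; have := hef.ne
  simp only [List.nodup_cons, List.mem_cons, List.not_mem_nil, List.nodup_nil]
  grind

theorem eq_of_path_alternating (h6 : (cycleGraph 6).Free G) {x a b c d e : V}
    (hb : b ∈ G.nbhd 2 x) (hd : d ∈ G.nbhd 2 x) (ha : G.Adj x a) (hc : G.Adj x c)
    (he : G.Adj x e) (hab : G.Adj a b) (hbc : G.Adj b c) (hcd : G.Adj c d) (hde : G.Adj d e)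
    (hbd : b ≠ d) (hac : a ≠ c) (hce : c ≠ e) : a = e := by
  rw [mem_nbhd_two] at hb hd
  by_contra hae
  refine h6.no_hexagon (x := x) ?_ ha hab hbc hcd hde he
  have := ha.ne; have := hc.ne; have := he.ne
  have := hab.ne; have := hbc.ne; have := hcd.ne; have := hde.ne
  simp only [List.nodup_cons, List.mem_cons, List.not_mem_nil, List.nodup_nil]
  grind

theorem eq_of_path_mixed (h7 : (cycleGraph 7).Free G) {x a b c d e f : V}
    (hb : b ∈ G.nbhd 2 x) (hc : c ∈ G.nbhd 2 x) (he : e ∈ G.nbhd 2 x) (ha : G.Adj x a)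
    (hd : G.Adj x d) (hf : G.Adj x f) (hab : G.Adj a b) (hbc : G.Adj b c) (hcd : G.Adj c d)
    (hde : G.Adj d e) (hef : G.Adj e f) (hbe : b ≠ e) (hce : c ≠ e) (had : a ≠ d)
    (hdf : d ≠ f) : a = f := by
  rw [mem_nbhd_two] at hb hc he
  by_contra haf
  refine h7.no_heptagon (x := x) ?_ ha hab hbc hcd hde hef hf
  have := ha.ne; have := hd.ne; have := hf.ne; have := hab.ne; have := hbc.ne; have := hcd.ne
  have := hde.ne; have := hef.ne
  simp only [List.nodup_cons, List.mem_cons, List.not_mem_nil, List.nodup_nil]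
  grind

/-- Of two vertices at distance two from `x` with a common neighbour at distance two from `x`
one can be dispensed with. -/
theorem Solvable.diff_singleton (h6 : (cycleGraph 6).Free G) (h7 : (cycleGraph 7).Free G)
    {x : V} {B : Set V} (hB : B ⊆ G.nbhd 2 x) {b c p : V} (hb : b ∈ B)
    (hc : c ∈ B) (hp : p ∈ B) (hcb : G.Adj c b) (hcp : G.Adj c p) (hpb : p ≠ b)
    (h : G.Solvable x B) : G.Solvable x (B \ {b}) := by
  obtain ⟨S, hSB, hS, hdom⟩ := h
  by_cases hbS : b ∈ S
  swap
  · exact ⟨S, fun s hs => ⟨hSB hs, fun h => hbS (h ▸ hs)⟩, hS, hdom⟩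
  have hcS : c ∉ S := fun hcS => hS hcS hbS hcb.ne hcb
  obtain ⟨a, hxa, hab⟩ := (mem_nbhd_two.1 (hB hb)).2.2
  -- Excluding `C_6` along `b, c, p` makes `a` the only neighbour in `N(x)` of both `b` and `p`;
  -- hence `b` is needed in `S` only for `a`.
  have hp_of : ∀ e, G.Adj x e → G.Adj e p → a = e := fun e he hep =>
    eq_of_path_three h6 (hB hb) (hB hc) (hB hp) hcb.symm hcp hpb.symm hxa he hab hep.symm
  obtain ⟨a', hxa', hap'⟩ := (mem_nbhd_two.1 (hB hp)).2.2
  obtain rfl := hp_of a' hxa' hap'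
  have hb_of : ∀ e, G.Adj x e → G.Adj e b → e = a := fun e he heb =>
    eq_of_path_three h6 (hB hb) (hB hc) (hB hp) hcb.symm hcp hpb.symm he hxa heb hap'.symm
  by_cases hd : ∃ s ∈ S, s ≠ b ∧ G.Adj a s
  · refine ⟨S \ {b}, fun s hs => ⟨hSB hs.1, hs.2⟩, hS.mono Set.sdiff_subset, ?_⟩
    intro e he
    obtain ⟨s, hs, hes⟩ := hdom e he
    by_cases hsb : s = b
    · subst hsb
      obtain rfl := hb_of e he hes
      obtain ⟨s', h1, h2, h3⟩ := hd
      exact ⟨s', ⟨h1, h2⟩, h3⟩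
    · exact ⟨s, ⟨hs, hsb⟩, hes⟩
  -- Here `b` alone dominates `a` and is exchanged for `p`. A neighbour `s` of `p` in `S` would
  -- continue the path `b, c, p`; excluding `C_7` then makes `s` a second dominator of `a`.
  · have hps : ∀ s ∈ S \ {b}, ¬ G.Adj p s := by
      rintro s ⟨hs, hsb⟩ hps
      have hsb : s ≠ b := hsb
      obtain ⟨e, he, hes⟩ := (mem_nbhd_two.1 (hB (hSB hs))).2.2
      obtain rfl := eq_of_path_four h7 (hB hb) (hB hc) (hB hp) (hB (hSB hs)) hcb.symm hcp hps
        hpb.symm hsb.symm (fun h => hcS (h ▸ hs)) hxa he hab hes.symm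
      exact hd ⟨s, hs, hsb, hes⟩
    refine ⟨insert p (S \ {b}), ?_, ?_, ?_⟩
    · rintro s (rfl | hs)
      · exact ⟨hp, hpb⟩
      · exact ⟨hSB hs.1, hs.2⟩
    · rintro s (rfl | hs) t (rfl | ht) hne
      · exact absurd rfl hne
      · exact hps t ht
      · exact fun h => hps s hs h.symm
      · exact hS hs.1 ht.1 hne
    · intro e he
      obtain ⟨s, hs, hes⟩ := hdom e he
      by_cases hsb : s = b
      · subst hsb
        obtain rfl := hb_of e he hes
        exact ⟨p, Or.inl rfl, hap'⟩
      · exact ⟨s, Or.inr ⟨hs, hsb⟩, hes⟩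

end SimpleGraph

/-! ### Autark partial choices and completeness of the deletion rules. -/

namespace SimpleGraph

variable {V : Type*} {G : SimpleGraph V}

/-- `T` is an independent subset of `B`, and every neighbour of `x` that loses a possible
dominator by choosing `T` is dominated by `T`. -/
structure IsAutark (G : SimpleGraph V) (x : V) (B T : Set V) : Prop where
  subset : T ⊆ B
  indep : G.IsIndepSet T
  closed : ∀ t ∈ T, ∀ w ∈ B, G.Adj w t → ∀ a, G.Adj x a → G.Adj a w → ∃ s ∈ T, G.Adj a s

/-- Each `u ∈ U` serves some `a` that `T` misses. If `u` were adjacent to a member of `T`,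
closedness of `T` would make `T` dominate that `a`; so `T` and `U` are compatible. -/
theorem IsAutark.union {x : V} {B T U : Set V} (hT : G.IsAutark x B T) (hUB : U ⊆ B)
    (hU : G.IsIndepSet U)
    (hnew : ∀ u ∈ U, ∃ a, G.Adj x a ∧ G.Adj a u ∧ ∀ s ∈ T, ¬ G.Adj a s)
    (hcl : ∀ u ∈ U, ∀ w ∈ B, G.Adj w u → ∀ a, G.Adj x a → G.Adj a w →
      ∃ s ∈ T ∪ U, G.Adj a s) :
    G.IsAutark x B (T ∪ U) := by
  have hno : ∀ t ∈ T, ∀ u ∈ U, ¬ G.Adj u t := by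
    intro t ht u hu hut
    obtain ⟨a, hxa, hau, hn⟩ := hnew u hu
    obtain ⟨s, hs, has⟩ := hT.closed t ht u (hUB hu) hut a hxa hau
    exact hn s hs has
  refine ⟨Set.union_subset hT.subset hUB, ?_, ?_⟩
  · rintro s (hs | hs) t (ht | ht) hne
    · exact hT.indep hs ht hne
    · exact fun h => hno s hs t ht h.symm
    · exact hno t ht s hs
    · exact hU hs ht hne
  · rintro t (ht | ht) w hw hwt a hxa haw
    · obtain ⟨s, hs, h⟩ := hT.closed t ht w hw hwt a hxa haw
      exact ⟨s, Or.inl hs, h⟩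
    · exact hcl t ht w hw hwt a hxa haw

/-- In a set on which `G` is a matching, an independent system of dominators exists as soon as
each of the vertices to be dominated has two neighbours and these are not shared. -/
theorem exists_indep_dominators [Fintype V] {B A : Set V}
    (hmatch : ∀ c ∈ B, ∀ b ∈ B, ∀ d ∈ B, G.Adj c b → G.Adj c d → b = d)
    (htwo : ∀ a ∈ A, ∃ b ∈ B, ∃ d ∈ B, b ≠ d ∧ G.Adj a b ∧ G.Adj a d)
    (hone : ∀ b ∈ B, ∀ a ∈ A, ∀ c ∈ A, G.Adj a b → G.Adj c b → a = c) :
    ∃ f : A → V, (∀ a, f a ∈ B ∧ G.Adj a (f a)) ∧ ∀ a c, ¬ G.Adj (f a) (f c) := by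
  classical
  let N : A → Finset V := fun a => Finset.univ.filter fun b => b ∈ B ∧ G.Adj a b
  -- `g b` is the matching class of `b`, with at most two elements. Hall's theorem is applied to
  -- classes rather than vertices, so that distinct representatives are automatically nonadjacent.
  let g : V → Finset V := fun b => Finset.univ.filter fun d => d ∈ B ∧ (d = b ∨ G.Adj b d)
  have hmem : ∀ a b, b ∈ N a ↔ b ∈ B ∧ G.Adj a b := by simp [N]
  have hg : ∀ b d, d ∈ g b ↔ d ∈ B ∧ (d = b ∨ G.Adj b d) := by simp [g]
  have hgadj : ∀ b ∈ B, ∀ d ∈ B, G.Adj b d → g b = g d := by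
    intro b hb d hd hbd
    ext e
    rw [hg, hg]
    constructor
    · rintro ⟨he, rfl | h⟩
      · exact ⟨he, Or.inr hbd.symm⟩
      · exact ⟨he, Or.inl (hmatch b hb e he d hd h hbd)⟩
    · rintro ⟨he, rfl | h⟩
      · exact ⟨he, Or.inr hbd⟩
      · exact ⟨he, Or.inl (hmatch d hd e he b hb h hbd.symm)⟩
  -- Double counting: the sets `N a` are disjoint of size at least two, and each class absorbs at
  -- most two vertices.
  have hall : ∀ s : Finset A, s.card ≤ (s.biUnion fun a => (N a).image g).card := by
    intro s
    have h1 : 2 * s.card ≤ (s.biUnion N).card := by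
      rw [Finset.card_biUnion]
      · rw [mul_comm, ← smul_eq_mul]
        refine Finset.card_nsmul_le_sum _ _ _ fun a _ => ?_
        obtain ⟨b, hb, d, hd, hbd, h1, h2⟩ := htwo a a.2
        exact Finset.one_lt_card.2 ⟨b, (hmem _ _).2 ⟨hb, h1⟩, d, (hmem _ _).2 ⟨hd, h2⟩, hbd⟩
      · intro a _ c _ hac
        refine Finset.disjoint_left.2 fun b hb hb' => hac ?_
        rw [hmem] at hb hb'
        exact Subtype.ext (hone b hb.1 a a.2 c c.2 hb.2 hb'.2)
    have h2 : (s.biUnion N).card ≤ 2 * ((s.biUnion N).image g).card := by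
      refine Finset.card_le_mul_card_image _ 2 fun y hy => ?_
      obtain ⟨b, hb, rfl⟩ := Finset.mem_image.1 hy
      obtain ⟨a, _, hb⟩ := Finset.mem_biUnion.1 hb
      rw [hmem] at hb
      by_contra hlt
      rw [not_le] at hlt
      obtain ⟨p, q, r, hp, hq, hr, hpq, hpr, hqr⟩ := Finset.two_lt_card_iff.1 hlt
      have key : ∀ p ∈ (s.biUnion N).filter (fun d => g d = g b), p ∈ B ∧ (p = b ∨ G.Adj b p) := by
        intro p hp
        rw [Finset.mem_filter, Finset.mem_biUnion] at hp
        obtain ⟨⟨c, _, hc⟩, h⟩ := hp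
        rw [hmem] at hc
        exact (hg b p).1 (h ▸ (hg p p).2 ⟨hc.1, Or.inl rfl⟩)
      have kp := key p hp
      have kq := key q hq
      have kr := key r hr
      have hm := hmatch b hb.1
      grind
    rw [← Finset.biUnion_image] at *
    omega
  obtain ⟨F, hF, hFm⟩ := (Finset.all_card_le_biUnion_card_iff_exists_injective _).1 hall
  have hF' : ∀ a : A, ∃ b, (b ∈ B ∧ G.Adj a b) ∧ g b = F a := by
    intro a
    obtain ⟨b, hb, h⟩ := Finset.mem_image.1 (hFm a)
    exact ⟨b, (hmem _ _).1 hb, h⟩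
  choose f hf hfF using hF'
  refine ⟨f, hf, fun a c hac => ?_⟩
  have := hgadj _ (hf a).1 _ (hf c).1 hac
  rw [hfF, hfF] at this
  rw [hF this] at hac
  exact hac.ne rfl

/-- `hunit` and `hres` say that the two propagation rules have nothing left to delete. The premise
in `hres` that `c` is the only neighbour of `w` in `N(x)` weakens what the algorithm must guarantee.
-/
theorem solvable_of_closed [Fintype V] (h6 : (cycleGraph 6).Free G) (h7 : (cycleGraph 7).Free G)
    {x : V} {B : Set V} (hB : B ⊆ G.nbhd 2 x)
    (hmatch : ∀ c ∈ B, ∀ b ∈ B, ∀ d ∈ B, G.Adj c b → G.Adj c d → b = d)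
    (hne : ∀ a, G.Adj x a → ∃ b ∈ B, G.Adj a b)
    (hunit : ∀ a, G.Adj x a → ∀ u ∈ B, G.Adj a u → (∀ v ∈ B, G.Adj a v → v = u) →
      ∀ d ∈ B, ¬ G.Adj u d)
    (hres : ∀ a c, G.Adj x a → G.Adj x c → ∀ u ∈ B, ∀ v ∈ B, ∀ w ∈ B, u ≠ v → u ≠ w →
      G.Adj a u → G.Adj a v → (∀ b ∈ B, G.Adj a b → b = u ∨ b = v) →
      G.Adj c u → G.Adj c w → (∀ b ∈ B, G.Adj c b → b = u ∨ b = w) →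
      (∀ e, G.Adj x e → G.Adj e w → e = c) → G.Adj v w → ∀ d ∈ B, ¬ G.Adj u d) :
    G.Solvable x B := by
  classical
  obtain ⟨T, hT⟩ : ∃ T, Maximal (G.IsAutark x B) T := by
    obtain ⟨T, -, hT⟩ := (Set.toFinite {T | G.IsAutark x B T}).exists_le_maximal
      (show ∅ ∈ {T | G.IsAutark x B T} from ⟨by simp, by simp, by simp⟩)
    exact ⟨T, hT⟩
  by_contra hcon
  obtain ⟨a₀, hxa₀, ha₀⟩ : ∃ a, G.Adj x a ∧ ∀ s ∈ T, ¬ G.Adj a s := by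
    by_contra h
    push Not at h
    exact hcon ⟨T, hT.prop.subset, hT.prop.indep, h⟩
  set A : Set V := {a | G.Adj x a ∧ ∀ s ∈ T, ¬ G.Adj a s} with hA
  -- Maximality of `T` in usable form: no nonempty `U` is autark relative to the set `A` of vertices
  -- that `T` leaves undominated.
  have hext : ∀ U ⊆ B, U.Nonempty → G.IsIndepSet U → (∀ u ∈ U, ∃ a ∈ A, G.Adj a u) →
      (∀ u ∈ U, ∀ w ∈ B, G.Adj w u → ∀ a ∈ A, G.Adj a w → ∃ s ∈ U, G.Adj a s) → False := by
    rintro U hUB ⟨u, hu⟩ hU hnew hcl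
    have haut : G.IsAutark x B (T ∪ U) := by
      refine hT.prop.union hUB hU ?_ ?_
      · intro u hu
        obtain ⟨a, ha, hau⟩ := hnew u hu
        exact ⟨a, ha.1, hau, ha.2⟩
      · intro u hu w hw hwu a hxa haw
        by_cases ha : a ∈ A
        · obtain ⟨s, hs, h⟩ := hcl u hu w hw hwu a ha haw
          exact ⟨s, Or.inr hs, h⟩
        · rw [hA, Set.mem_ofPred_eq] at ha
          push Not at ha
          obtain ⟨s, hs, h⟩ := ha hxa
          exact ⟨s, Or.inl hs, h⟩
    obtain ⟨a, ha, hau⟩ := hnew u hu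
    exact ha.2 u (hT.le_of_ge haut Set.subset_union_left (Or.inr hu)) hau
  have hpartner : ∀ a ∈ A, ∀ b ∈ B, G.Adj a b → ∃ d ∈ B, G.Adj b d := by
    intro a ha b hb hab
    by_contra h
    push Not at h
    refine hext {b} (by simpa using hb) (by simp) (by simp) (by simpa using ⟨a, ha, hab⟩) ?_
    rintro u rfl w hw hwu
    exact absurd hwu.symm (h w hw)
  have hsecond : ∀ a ∈ A, ∀ b ∈ B, G.Adj a b → ∃ d ∈ B, d ≠ b ∧ G.Adj a d := by
    intro a ha b hb hab
    by_contra h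
    push Not at h
    obtain ⟨d, hd, hbd⟩ := hpartner a ha b hb hab
    exact hunit a ha.1 b hb hab (fun v hv hav => by_contra fun hvb => h v hv hvb hav) d hd hbd
  -- The heart of the argument: a candidate `b` shared by `a₁` and `a₂` produces exactly the
  -- configuration excluded by `hres`.
  have hone : ∀ b ∈ B, ∀ a ∈ A, ∀ c ∈ A, G.Adj a b → G.Adj c b → a = c := by
    intro b hb a₁ ha₁ a₂ ha₂ h1 h2
    by_contra h12
    obtain ⟨d, hd, hbd⟩ := hpartner a₁ ha₁ b hb h1
    -- Otherwise choosing `b` harms nobody, since everyone in `A` who loses `d` is served by `b`,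
    -- and `{b}` would extend `T`.
    obtain ⟨a₃, ha₃, h3d, h3b⟩ : ∃ a₃ ∈ A, G.Adj a₃ d ∧ ¬ G.Adj a₃ b := by
      by_contra h
      push Not at h
      refine hext {b} (by simpa using hb) (by simp) (by simp) (by simpa using ⟨a₁, ha₁, h1⟩) ?_
      rintro u rfl w hw hwu a ha haw
      obtain rfl := hmatch u hb w hw d hd hwu.symm hbd
      exact ⟨u, rfl, h a ha haw⟩
    have h31 : a₃ ≠ a₁ := fun h => h3b (h ▸ h1)
    have h32 : a₃ ≠ a₂ := fun h => h3b (h ▸ h2)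
    have hx1 := ha₁.1
    have hx2 := ha₂.1
    have hx3 := ha₃.1
    have hd' : ∀ a a', G.Adj x a → G.Adj x a' → G.Adj a b → G.Adj a' b → a ≠ a' →
        a₃ ≠ a → a₃ ≠ a' → ¬ G.Adj a d := fun a a' hxa hxa' hab hab' hne hne1 hne2 had =>
      hne2 (eq_of_path_alternating h6 (hB hb) (hB hd) hxa' hxa hx3 hab' hab.symm had h3d.symm
        hbd.ne hne.symm hne1.symm).symm
    -- Excluding `C_6` leaves `a'` as the only possible further neighbour of `p` in `N(x)`, and then
    -- `x, a₃, d, b, a, p, a'` is a `C_7`.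
    have hpriv : ∀ a a', G.Adj x a → G.Adj x a' → G.Adj a b → G.Adj a' b → a ≠ a' →
        a₃ ≠ a → a₃ ≠ a' → ∀ p ∈ B, p ≠ b → G.Adj a p → ∀ e, G.Adj x e → G.Adj e p → e = a := by
      intro a a' hxa hxa' hab hab' hne hne1 hne2 p hp hpb hap e hxe hep
      have hpd : p ≠ d := fun h => hd' a a' hxa hxa' hab hab' hne hne1 hne2 (h ▸ hap)
      by_contra hea
      obtain rfl := eq_of_path_alternating h6 (hB hb) (hB hp) hxa' hxa hxe hab' hab.symm hap
        hep.symm hpb.symm hne.symm (Ne.symm hea)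
      exact hne2 (eq_of_path_mixed h7 (hB hd) (hB hb) (hB hp) hx3 hxa hxe h3d hbd.symm hab.symm
        hap hep.symm hpd.symm hpb.symm hne1 hne)
    -- The cycle `x, e, q, p, a, b, a'` shows that choosing `p` can harm only `a` and `a'`.
    have hpart : ∀ a a', G.Adj x a → G.Adj x a' → G.Adj a b → G.Adj a' b → a ≠ a' →
        a₃ ≠ a → a₃ ≠ a' → ∀ p ∈ B, p ≠ b → G.Adj a p → ∀ q ∈ B, G.Adj q p →
        ∀ e, G.Adj x e → G.Adj e q → e = a ∨ e = a' := by
      intro a a' hxa hxa' hab hab' hne hne1 hne2 p hp hpb hap q hq hqp e hxe heq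
      have hpd : p ≠ d := fun h => hd' a a' hxa hxa' hab hab' hne hne1 hne2 (h ▸ hap)
      have hqb : q ≠ b := by
        rintro rfl
        exact hpd (hmatch q hb p hp d hd hqp hbd)
      by_contra hea
      push Not at hea
      exact hea.2 (eq_of_path_mixed h7 (hB hq) (hB hp) (hB hb) hxe hxa hxa' heq hqp hap.symm
        hab hab'.symm hqb hpb hea.1 hne)
    -- If `p` and `q` were nonadjacent, `{p, q}` would extend `T`: only `a₁` and `a₂` can be harmed,
    -- and both are served. With the matching condition, adjacency makes `p` and `q` unique.
    have hadj : ∀ p ∈ B, p ≠ b → G.Adj a₁ p → ∀ q ∈ B, q ≠ b → G.Adj a₂ q → G.Adj p q := by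
      intro p hp hpb h1p q hq hqb h2q
      by_contra hpq
      refine hext {p, q} ?_ ⟨p, by simp⟩ ?_ ?_ ?_
      · rintro u (rfl | rfl) <;> assumption
      · rintro u (rfl | rfl) w (rfl | rfl) hne
        · exact absurd rfl hne
        · exact hpq
        · exact fun h => hpq h.symm
        · exact absurd rfl hne
      · rintro u (rfl | rfl)
        exacts [⟨a₁, ha₁, h1p⟩, ⟨a₂, ha₂, h2q⟩]
      · intro u hu w hw hwu a ha haw
        have : a = a₁ ∨ a = a₂ := by
          rcases hu with rfl | rfl
          · exact hpart a₁ a₂ hx1 hx2 h1 h2 h12 h31 h32 u hp hpb h1p w hw hwu a ha.1 haw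
          · exact (hpart a₂ a₁ hx2 hx1 h2 h1 (Ne.symm h12) h32 h31 u hq hqb h2q w hw hwu
              a ha.1 haw).symm
        rcases this with rfl | rfl
        exacts [⟨p, by simp, h1p⟩, ⟨q, by simp, h2q⟩]
    obtain ⟨p, hp, hpb, h1p⟩ := hsecond a₁ ha₁ b hb h1
    obtain ⟨q, hq, hqb, h2q⟩ := hsecond a₂ ha₂ b hb h2
    have hpq := hadj p hp hpb h1p q hq hqb h2q
    refine hres a₁ a₂ hx1 hx2 b hb p hp q hq hpb.symm hqb.symm h1 h1p ?_ h2 h2q ?_ ?_ hpq d hd hbd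
    · intro v hv h1v
      by_contra hv'
      push Not at hv'
      exact hv'.2 (hmatch q hq v hv p hp (hadj v hv hv'.1 h1v q hq hqb h2q).symm hpq.symm)
    · intro v hv h2v
      by_contra hv'
      push Not at hv'
      exact hv'.2 (hmatch p hp v hv q hq (hadj p hp hpb h1p v hv hv'.1 h2v) hpq)
    · exact hpriv a₂ a₁ hx2 hx1 h2 h1 (Ne.symm h12) h32 h31 q hq hqb h2q
  obtain ⟨f, hf, hind⟩ := exists_indep_dominators (A := A) hmatch (fun a ha => by
    obtain ⟨b, hb, hab⟩ := hne a ha.1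
    obtain ⟨d, hd, hdb, had⟩ := hsecond a ha b hb hab
    exact ⟨b, hb, d, hd, hdb.symm, hab, had⟩) hone
  refine hext (Set.range f) ?_ ⟨f ⟨a₀, hxa₀, ha₀⟩, _, rfl⟩ ?_ ?_ ?_
  · rintro _ ⟨a, rfl⟩
    exact (hf a).1
  · rintro _ ⟨a, rfl⟩ _ ⟨c, rfl⟩ -
    exact hind a c
  · rintro _ ⟨a, rfl⟩
    exact ⟨a, a.2, (hf a).2⟩
  · intro _ _ _ _ _ a ha _
    exact ⟨f ⟨a, ha⟩, ⟨_, rfl⟩, (hf ⟨a, ha⟩).2⟩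

end SimpleGraph

/-! ### A program logic with time bounds. -/

namespace RAM

/-- Started in `s`, the program `p` halts within `T` steps in a configuration satisfying `Q`. -/
def Within (p : Prog) (s : State) (T : ℕ) (Q : State → Prop) : Prop :=
  ∃ t s', Exec p s t s' ∧ t ≤ T ∧ Q s'

theorem Within.mono {p : Prog} {s : State} {T T' : ℕ} {Q Q' : State → Prop}
    (h : Within p s T Q) (hT : T ≤ T') (hQ : ∀ s, Q s → Q' s) : Within p s T' Q' := by
  obtain ⟨t, s', h, ht, hq⟩ := h
  exact ⟨t, s', h, ht.trans hT, hQ _ hq⟩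

theorem Within.seq {p q : Prog} {s : State} {T₁ T₂ : ℕ} {R Q : State → Prop}
    (hp : Within p s T₁ R) (hq : ∀ s, R s → Within q s T₂ Q) :
    Within (.seq p q) s (T₁ + T₂) Q := by
  obtain ⟨t₁, s₁, h₁, ht₁, hr⟩ := hp
  obtain ⟨t₂, s₂, h₂, ht₂, hQ⟩ := hq s₁ hr
  exact ⟨_, s₂, .seq h₁ h₂, add_le_add ht₁ ht₂, hQ⟩

theorem Within.loop {b : Test} {p : Prog} {c : ℕ} (I : State → Prop) (μ : State → ℕ)
    (hbody : ∀ s, I s → b.Holds s → Within p s c fun s' => I s' ∧ μ s' < μ s)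
    {s : State} (hs : I s) :
    Within (.loop b p) s ((c + 1) * μ s + 1) fun s' => I s' ∧ ¬ b.Holds s' := by
  induction h : μ s using Nat.strong_induction_on generalizing s with
  | _ m ih =>
    subst h
    by_cases hb : b.Holds s
    · obtain ⟨t₁, s₁, h₁, ht₁, hI, hμ⟩ := hbody s hs hb
      obtain ⟨t₂, s₂, h₂, ht₂, hQ⟩ := ih _ hμ hI rfl
      refine ⟨_, s₂, .loopStep hb h₁ h₂, ?_, hQ⟩
      have : (c + 1) * (μ s₁ + 1) ≤ (c + 1) * μ s := Nat.mul_le_mul_left _ hμ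
      linarith
    · exact ⟨1, s, .loopExit hb, by omega, hs, hb⟩

/-- The number of steps of a program without loops is at most `p.cost`. -/
def Prog.cost : Prog → ℕ
  | .op _ => 1
  | .seq p q => p.cost + q.cost
  | .branch _ p q => p.cost + q.cost + 1
  | .loop _ _ => 0

/-- The weakest precondition of a program without loops. -/
def Prog.wp : Prog → (State → Prop) → State → Prop
  | .op o, Q, s => Q (o.apply s)
  | .seq p q, Q, s => p.wp (q.wp Q) s
  | .branch b p q, Q, s => (b.Holds s → p.wp Q s) ∧ (¬ b.Holds s → q.wp Q s)
  | .loop _ _, _, _ => False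

/-- A loop has precondition `False`, so its nominal cost `0` is never used. -/
theorem Prog.within_of_wp (p : Prog) {Q : State → Prop} {s : State} (h : p.wp Q s) :
    Within p s p.cost Q := by
  induction p generalizing Q s with
  | op o => exact ⟨1, _, .op o s, le_rfl, h⟩
  | seq p q ihp ihq => exact Within.seq (ihp h) fun s hs => ihq hs
  | branch b p q ihp ihq =>
    by_cases hb : b.Holds s
    · obtain ⟨t, s', h, ht, hQ⟩ := ihp (h.1 hb)
      exact ⟨t + 1, s', .branchTrue hb h, by simp only [Prog.cost]; omega, hQ⟩
    · obtain ⟨t, s', h, ht, hQ⟩ := ihq (h.2 hb)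
      exact ⟨t + 1, s', .branchFalse hb h, by simp only [Prog.cost]; omega, hQ⟩
  | loop b p => exact h.elim

/-- `for r_i := 0` to `r_j - 1` do `p`. -/
def forLoop (i j : ℕ) (p : Prog) : Prog :=
  .seq (.op (.const i 0)) (.loop (.lt i j) (.seq p (.op (.inc i))))

/-- The body `p` sees the counter `k` in `r_i` and must restore it; `I k` is the invariant. -/
theorem within_forLoop {i j N : ℕ} {p : Prog} (I : ℕ → State → Prop) {s : State}
    (hs : s.reg j = N) (hij : i ≠ j) (h0 : I 0 (s.setReg i 0))
    (hbody : ∀ k < N, ∀ s, s.reg i = k → s.reg j = N → I k s →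
      p.wp (fun s' => s'.reg i = k ∧ s'.reg j = N ∧ I (k + 1) (s'.setReg i (k + 1))) s) :
    Within (forLoop i j p) s ((p.cost + 2) * N + 2) fun s' => I N s' := by
  have hloop := Within.loop (b := .lt i j) (p := .seq p (.op (.inc i))) (c := p.cost + 1)
    (fun s => s.reg i ≤ N ∧ s.reg j = N ∧ I (s.reg i) s) (fun s => N - s.reg i) (by
      rintro s ⟨hi, hj, hI⟩ hb
      have hb : s.reg i < s.reg j := hb
      rw [hj] at hb
      refine Within.seq (Prog.within_of_wp p (hbody (s.reg i) hb s rfl hj hI)) ?_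
      rintro s' ⟨hi', hj', hI'⟩
      refine ⟨1, _, .op _ _, le_rfl, ?_⟩
      have h1 : (Op.inc i).apply s' = s'.setReg i (s.reg i + 1) := by rw [← hi']; rfl
      rw [h1]
      have h2 : (s'.setReg i (s.reg i + 1)).reg i = s.reg i + 1 := by simp [State.setReg]
      have h3 : (s'.setReg i (s.reg i + 1)).reg j = N := by
        simpa [State.setReg, hij.symm] using hj'
      dsimp only
      rw [h2]
      exact ⟨⟨hb, h3, hI'⟩, by omega⟩)
    (s := s.setReg i 0) (by simpa [State.setReg, hij.symm, hs] using h0)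
  refine (Within.seq (T₁ := 1) (T₂ := (p.cost + 2) * N + 1) (R := fun s' => s' = s.setReg i 0)
    ⟨1, _, .op _ _, le_rfl, rfl⟩ ?_).mono (by omega) fun _ h => h
  rintro s' rfl
  refine hloop.mono (by simp [State.setReg]) ?_
  rintro s' ⟨⟨hi, hj, hI⟩, hb⟩
  have hb : ¬ s'.reg i < s'.reg j := hb
  rwa [show s'.reg i = N by omega] at hI

end RAM

/-! ### Array invariants and soundness of the deletions. -/

namespace RAM

open SimpleGraph

variable {n : ℕ}

/-- The arcs of `G` are the pairs `(sr e, ds e)` with `e < M`, without repetition. -/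
structure Arcs (G : SimpleGraph (Fin n)) (M : ℕ) (sr ds : ℕ → ℕ) : Prop where
  adj : ∀ e < M, ∃ u w : Fin n, sr e = u ∧ ds e = w ∧ G.Adj u w
  exists_of_adj : ∀ u w : Fin n, G.Adj u w → ∃ e < M, sr e = u ∧ ds e = w
  inj : ∀ e < M, ∀ e' < M, sr e = sr e' → ds e = ds e' → e = e'

/-- The vertices at which the array `al` does not vanish. -/
def live (n : ℕ) (al : ℕ → ℕ) : Set (Fin n) := {v | al v ≠ 0}

theorem mem_live {al : ℕ → ℕ} {v : Fin n} : v ∈ live n al ↔ al v ≠ 0 := Iff.rfl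

theorem update_apply_fin {f : ℕ → ℕ} {a b : Fin n} {c : ℕ} :
    Function.update f a c b = if b = a then c else f b := by
  simp [Function.update_apply, Fin.ext_iff]

theorem live_update_zero {al : ℕ → ℕ} {d : Fin n} :
    live n (Function.update al d 0) = live n al \ {d} := by
  ext v
  simp only [mem_live, update_apply_fin, Set.mem_sdiff, Set.mem_singleton_iff]
  split_ifs <;> simp_all

/-- `al` marks candidates for the dominators of the neighbours of `x`, `own` maps each candidate to
a neighbour of `x`, `par` maps each candidate to one of its neighbours or to `x`, and each arc
between candidates among the first `k` arcs is of the form `(c, par c)`. -/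
structure Core (G : SimpleGraph (Fin n)) (x : Fin n) (sr ds : ℕ → ℕ) (k : ℕ)
    (al par own : ℕ → ℕ) : Prop where
  subset : live n al ⊆ G.nbhd 2 x
  solvable : G.Solvable x (G.nbhd 2 x) → G.Solvable x (live n al)
  par_spec : ∀ v ∈ live n al, par v = x ∨ ∃ w : Fin n, par v = w ∧ G.Adj v w
  own_spec : ∀ v ∈ live n al, ∃ a : Fin n, own v = a ∧ G.Adj x a ∧ G.Adj a v
  arc : ∀ e < k, al (sr e) ≠ 0 → al (ds e) ≠ 0 → par (sr e) = ds e

section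

variable {G : SimpleGraph (Fin n)} {x : Fin n} {sr ds al par own : ℕ → ℕ} {k M : ℕ}

theorem Core.al_x (h : Core G x sr ds k al par own) : al x = 0 := by
  by_contra hx
  exact (mem_nbhd_two.1 (h.subset (show x ∈ live n al from hx))).1 rfl

theorem Core.adj_par (h : Core G x sr ds k al par own) {v : Fin n} (hv : al v ≠ 0)
    (hp : al (par v) ≠ 0) : ∃ w : Fin n, par v = w ∧ G.Adj v w := by
  rcases h.par_spec v hv with hx | hw
  · exact absurd (hx ▸ h.al_x) hp
  · exact hw

theorem Core.kill (h : Core G x sr ds k al par own) {d : Fin n}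
    (hd : G.Solvable x (live n al) → G.Solvable x (live n al \ {d})) :
    Core G x sr ds k (Function.update al d 0) par own := by
  have hle : ∀ v ∈ live n (Function.update al d 0), v ∈ live n al := by
    rw [live_update_zero]
    exact fun v hv => hv.1
  have hle' : ∀ j, Function.update al d 0 j ≠ 0 → al j ≠ 0 := by
    intro j
    rw [Function.update_apply]
    split_ifs <;> simp
  refine ⟨fun v hv => h.subset (hle v hv), fun hs => ?_, fun v hv => h.par_spec v (hle v hv),
    fun v hv => h.own_spec v (hle v hv), fun e he h1 h2 => h.arc e he (hle' _ h1) (hle' _ h2)⟩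
  rw [live_update_zero]
  exact hd (h.solvable hs)

theorem Core.succ_of_dead (h : Core G x sr ds k al par own)
    (hk : al (sr k) = 0 ∨ al (ds k) = 0 ∨ par (sr k) = ds k) :
    Core G x sr ds (k + 1) al par own := by
  refine ⟨h.subset, h.solvable, h.par_spec, h.own_spec, fun e he h1 h2 => ?_⟩
  rcases Nat.lt_succ_iff_lt_or_eq.1 he with he | rfl
  · exact h.arc e he h1 h2
  · tauto

/-- An earlier arc from this source to a live target would have that target as the current pointer.
As the pointer is dead, no such arc exists and overwriting it is safe. -/
theorem Core.succ_of_setPar (harcs : Arcs G M sr ds) (hk : k < M)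
    (h : Core G x sr ds k al par own) (hp : al (par (sr k)) = 0) :
    Core G x sr ds (k + 1) al (Function.update par (sr k) (ds k)) own := by
  refine ⟨h.subset, h.solvable, fun v hv => ?_, h.own_spec, fun e he h1 h2 => ?_⟩
  · obtain ⟨u, w, hu, hw, huw⟩ := harcs.adj k hk
    rw [hu, hw, update_apply_fin]
    split_ifs with hvu
    · exact Or.inr ⟨w, rfl, hvu ▸ huw⟩
    · exact h.par_spec v hv
  · rw [Function.update_apply]
    split_ifs with hs
    · rcases Nat.lt_succ_iff_lt_or_eq.1 he with he | rfl
      · have := h.arc e he h1 h2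
        rw [hs] at this
        rw [this] at hp
        exact absurd hp h2
      · rfl
    · rcases Nat.lt_succ_iff_lt_or_eq.1 he with he | rfl
      · exact h.arc e he h1 h2
      · exact absurd rfl hs

/-- The pointer and the target are two live neighbours of the source, so `Solvable.diff_singleton`
permits deleting the target. -/
theorem Core.succ_of_kill (h6 : (cycleGraph 6).Free G) (h7 : (cycleGraph 7).Free G)
    (harcs : Arcs G M sr ds) (hk : k < M)
    (h : Core G x sr ds k al par own) (h1 : al (sr k) ≠ 0) (h2 : al (ds k) ≠ 0)
    (hp : al (par (sr k)) ≠ 0) (hne : par (sr k) ≠ ds k) :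
    Core G x sr ds (k + 1) (Function.update al (ds k) 0) par own := by
  obtain ⟨u, w, hu, hw, huw⟩ := harcs.adj k hk
  rw [hu] at h1 hp hne
  rw [hw] at h2 hne ⊢
  obtain ⟨p, hp', hup⟩ := h.adj_par h1 hp
  rw [hp'] at hp hne
  refine (h.kill fun hs => ?_).succ_of_dead (by simp [hw])
  refine hs.diff_singleton h6 h7 h.subset h2 h1 hp huw hup ?_
  rintro rfl
  exact hne rfl

/-- The live neighbours of `a` along the first `k` arcs. -/
noncomputable def liveNbrs (sr ds : ℕ → ℕ) (k : ℕ) (al : ℕ → ℕ) (a : Fin n) : Finset (Fin n) :=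
  open Classical in
  Finset.univ.filter fun v => al v ≠ 0 ∧ ∃ e < k, sr e = a ∧ ds e = v

theorem mem_liveNbrs {a v : Fin n} :
    v ∈ liveNbrs sr ds k al a ↔ al v ≠ 0 ∧ ∃ e < k, sr e = a ∧ ds e = v := by
  simp [liveNbrs]

theorem Arcs.mem_liveNbrs (harcs : Arcs G M sr ds) {a v : Fin n} :
    v ∈ liveNbrs sr ds M al a ↔ al v ≠ 0 ∧ G.Adj a v := by
  rw [RAM.mem_liveNbrs]
  refine and_congr_right fun _ => ⟨?_, harcs.exists_of_adj a v⟩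
  rintro ⟨e, he, hs, hd⟩
  obtain ⟨u, w, hu, hw, huw⟩ := harcs.adj e he
  rw [Fin.ext (hs.symm.trans hu), Fin.ext (hd.symm.trans hw)]
  exact huw

/-- `K a` is the size of `N`, truncated at three, `F a` is an element of `N`
and `H a` a second one. -/
structure Counted (K F H : ℕ → ℕ) (a : Fin n) (N : Finset (Fin n)) : Prop where
  card : K a = min 3 N.card
  first : 1 ≤ N.card → ∃ f ∈ N, F a = f
  second : 2 ≤ N.card → ∃ f ∈ N, ∃ g ∈ N, f ≠ g ∧ F a = f ∧ H a = g

variable {A K F H : ℕ → ℕ}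

theorem liveNbrs_succ_of_ne {a : Fin n} (h : sr k ≠ a ∨ al (ds k) = 0) :
    liveNbrs sr ds (k + 1) al a = liveNbrs sr ds k al a := by
  ext v
  rw [mem_liveNbrs, mem_liveNbrs]
  refine and_congr_right fun hv => ⟨?_, ?_⟩
  · rintro ⟨e, he, hs, hd⟩
    rcases Nat.lt_succ_iff_lt_or_eq.1 he with he | rfl
    · exact ⟨e, he, hs, hd⟩
    · rcases h with h | h
      · exact absurd hs h
      · exact absurd (hd ▸ h) hv
  · rintro ⟨e, he, h⟩
    exact ⟨e, by omega, h⟩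

theorem liveNbrs_succ (harcs : Arcs G M sr ds) (hk : k < M) {a v : Fin n} (hs : sr k = a)
    (hd : ds k = v) (hv : al v ≠ 0) :
    v ∉ liveNbrs sr ds k al a ∧
      liveNbrs sr ds (k + 1) al a = insert v (liveNbrs sr ds k al a) := by
  constructor
  · rw [mem_liveNbrs]
    rintro ⟨-, e, he, h1, h2⟩
    have := harcs.inj e (he.trans hk) k hk (h1.trans hs.symm) (h2.trans hd.symm)
    omega
  · ext w
    rw [Finset.mem_insert, mem_liveNbrs, mem_liveNbrs]
    constructor
    · rintro ⟨hw, e, he, h1, h2⟩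
      rcases Nat.lt_succ_iff_lt_or_eq.1 he with he | rfl
      · exact Or.inr ⟨hw, e, he, h1, h2⟩
      · exact Or.inl (Fin.ext (h2.symm.trans hd))
    · rintro (rfl | ⟨hw, e, he, h⟩)
      · exact ⟨hv, k, by omega, hs, hd⟩
      · exact ⟨hw, e, by omega, h⟩

theorem Counted.congr {K' F' H' : ℕ → ℕ} {a : Fin n} {N : Finset (Fin n)}
    (h : Counted K F H a N) (hK : K' a = K a) (hF : F' a = F a) (hH : H' a = H a) :
    Counted K' F' H' a N :=
  ⟨hK.trans h.card, hF ▸ h.first, by rw [hF, hH]; exact h.second⟩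

theorem Counted.insert_first {a v : Fin n} {N : Finset (Fin n)} (h : Counted K F H a N)
    (hv : v ∉ N) (hK : K a = 0) :
    Counted (Function.update K a 1) (Function.update F a v) H a (insert v N) := by
  have h0 : N.card = 0 := by have := h.card; omega
  have hc : (insert v N).card = 1 := by rw [Finset.card_insert_of_notMem hv, h0]
  refine ⟨by simp [hc], fun _ => ⟨v, by simp, by simp⟩, fun h2 => by omega⟩

theorem Counted.insert_second {a v : Fin n} {N : Finset (Fin n)} (h : Counted K F H a N)
    (hv : v ∉ N) (hK : K a = 1) :
    Counted (Function.update K a 2) F (Function.update H a v) a (insert v N) := by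
  have h0 : N.card = 1 := by have := h.card; omega
  have hc : (insert v N).card = 2 := by rw [Finset.card_insert_of_notMem hv, h0]
  obtain ⟨f, hf, hfF⟩ := h.first h0.ge
  refine ⟨by simp [hc], fun _ => ⟨f, by simp [hf], hfF⟩, fun h2 => ⟨f, by simp [hf], v, by simp,
    fun h => hv (h ▸ hf), hfF, by simp⟩⟩

theorem Counted.insert_more {a v : Fin n} {N : Finset (Fin n)} (h : Counted K F H a N)
    (hv : v ∉ N) (hK : K a ≠ 0) (hK' : K a ≠ 1) :
    Counted (Function.update K a 3) F H a (insert v N) := by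
  have h0 : 2 ≤ N.card := by have := h.card; omega
  have hc := Finset.card_insert_of_notMem hv
  obtain ⟨f, hf, g, hg, h⟩ := h.second h0
  exact ⟨by simp [hc]; omega, fun _ => ⟨f, by simp [hf], h.2.1⟩,
    fun _ => ⟨f, by simp [hf], g, by simp [hg], h⟩⟩

/-- The one of `F a`, `H a` that differs from `v`. -/
def other (F H : ℕ → ℕ) (a v : ℕ) : ℕ := if F a = v then H a else F a

theorem Counted.eq_of_one {a v : Fin n} {N : Finset (Fin n)} (h : Counted K F H a N)
    (hK : K a = 1) (hv : v ∈ N) : N = {v} := by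
  have h0 : N.card = 1 := by have := h.card; omega
  obtain ⟨w, rfl⟩ := Finset.card_eq_one.1 h0
  rw [Finset.mem_singleton.1 hv]

theorem Counted.eq_of_two {a v : Fin n} {N : Finset (Fin n)} (h : Counted K F H a N)
    (hK : K a = 2) (hv : v ∈ N) : ∃ u, u ≠ v ∧ other F H a v = u ∧ N = {u, v} := by
  have h0 : N.card = 2 := by have := h.card; omega
  obtain ⟨f, hf, g, hg, hfg, hF, hH⟩ := h.second h0.ge
  have hN : N = {f, g} := by
    refine (Finset.eq_of_subset_of_card_le ?_ ?_).symm
    · rintro w hw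
      rcases Finset.mem_insert.1 hw with rfl | hw
      · exact hf
      · rw [Finset.mem_singleton.1 hw]; exact hg
    · rw [h0, Finset.card_pair hfg]
  rw [hN, Finset.mem_insert, Finset.mem_singleton] at hv
  rcases hv with rfl | rfl
  · exact ⟨g, hfg.symm, by simp [other, hF, hH], by rw [hN, Finset.pair_comm]⟩
  · refine ⟨f, hfg, ?_, hN⟩
    rw [other, hF, if_neg fun h => hfg (Fin.ext h)]

/-- Propagation along arc `e` has no effect on `al`. -/
structure ClosedAt (sr ds A K F H al par own : ℕ → ℕ) (e : ℕ) : Prop where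
  unit : A (sr e) ≠ 0 → al (ds e) ≠ 0 → K (sr e) = 1 → al (par (ds e)) = 0
  resolve : A (sr e) ≠ 0 → al (ds e) ≠ 0 → K (sr e) = 2 → al (par (ds e)) ≠ 0 →
    K (own (par (ds e))) = 2 →
    other F H (sr e) (ds e) = other F H (own (par (ds e))) (par (ds e)) →
    al (par (other F H (sr e) (ds e))) = 0

/-- The neighbours of `a` are controlled in a larger set `C` because counts are taken at the start
of a round and may be outdated by later deletions; as upper bounds they remain valid. The same
applies to `Solvable.kill_resolve`. -/
theorem Solvable.kill_unit {x : Fin n} {B C : Set (Fin n)} (h : G.Solvable x B) (hBC : B ⊆ C)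
    {a v d : Fin n} (hxa : G.Adj x a) (hN : ∀ b ∈ C, G.Adj a b → b = v) (hd : G.Adj v d) :
    G.Solvable x (B \ {d}) := by
  obtain ⟨S, hSB, hS, hdom⟩ := h
  refine ⟨S, fun s hs => ⟨hSB hs, ?_⟩, hS, hdom⟩
  rintro rfl
  obtain ⟨t, ht, hat⟩ := hdom a hxa
  obtain rfl := hN t (hBC (hSB ht)) hat
  exact hS ht hs hd.ne hd

theorem Solvable.kill_resolve {x : Fin n} {B C : Set (Fin n)} (h : G.Solvable x B) (hBC : B ⊆ C)
    {a c u v w d : Fin n} (hxa : G.Adj x a) (hxc : G.Adj x c)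
    (ha : ∀ b ∈ C, G.Adj a b → b = u ∨ b = v) (hc : ∀ b ∈ C, G.Adj c b → b = u ∨ b = w)
    (hvw : G.Adj v w) (hd : G.Adj u d) : G.Solvable x (B \ {d}) := by
  obtain ⟨S, hSB, hS, hdom⟩ := h
  refine ⟨S, fun s hs => ⟨hSB hs, ?_⟩, hS, hdom⟩
  rintro rfl
  obtain ⟨t, ht, hat⟩ := hdom a hxa
  obtain ⟨t', ht', hct⟩ := hdom c hxc
  rcases ha t (hBC (hSB ht)) hat with rfl | rfl
  · exact hS ht hs hd.ne hd
  rcases hc t' (hBC (hSB ht')) hct with rfl | rfl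
  · exact hS ht' hs hd.ne hd
  · exact hS ht ht' hvw.ne hvw

theorem Core.kill_unit {al₀ : ℕ → ℕ} (harcs : Arcs G M sr ds)
    (h : Core G x sr ds M al par own) (hle : live n al ⊆ live n al₀)
    (hA : ∀ v : Fin n, A v ≠ 0 ↔ G.Adj x v)
    (hcnt : ∀ a : Fin n, A a ≠ 0 → Counted K F H a (liveNbrs sr ds M al₀ a)) (hk : k < M)
    (h1 : A (sr k) ≠ 0) (h2 : al (ds k) ≠ 0) (hK : K (sr k) = 1) (hp : al (par (ds k)) ≠ 0) :
    Core G x sr ds M (Function.update al (par (ds k)) 0) par own ∧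
      ∃ d : Fin n, par (ds k) = d := by
  obtain ⟨a, v, ha, hv, hav⟩ := harcs.adj k hk
  rw [ha] at h1 hK
  rw [hv] at h2 hp ⊢
  obtain ⟨d, hd, hvd⟩ := h.adj_par h2 hp
  have hN := (hcnt a h1).eq_of_one hK (v := v) (harcs.mem_liveNbrs.2 ⟨hle h2, hav⟩)
  rw [hd]
  refine ⟨h.kill fun hs => Solvable.kill_unit hs hle ((hA a).1 h1) (v := v) ?_ hvd, d, rfl⟩
  intro b hb hab
  have : b ∈ liveNbrs sr ds M al₀ a := harcs.mem_liveNbrs.2 ⟨hb, hab⟩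
  rwa [hN, Finset.mem_singleton] at this

theorem Core.kill_resolve {al₀ : ℕ → ℕ} (harcs : Arcs G M sr ds)
    (h : Core G x sr ds M al par own) (hle : live n al ⊆ live n al₀)
    (hA : ∀ v : Fin n, A v ≠ 0 ↔ G.Adj x v)
    (hcnt : ∀ a : Fin n, A a ≠ 0 → Counted K F H a (liveNbrs sr ds M al₀ a))
    (hle' : ∀ v ∈ live n al₀, par v = x ∨ ∃ w : Fin n, par v = w ∧ G.Adj v w) (hk : k < M)
    (h1 : A (sr k) ≠ 0) (h2 : al (ds k) ≠ 0) (hK : K (sr k) = 2) (hp : al (par (ds k)) ≠ 0)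
    (hK' : K (own (par (ds k))) = 2)
    (ho : other F H (sr k) (ds k) = other F H (own (par (ds k))) (par (ds k)))
    (hd : al (par (other F H (sr k) (ds k))) ≠ 0) :
    Core G x sr ds M (Function.update al (par (other F H (sr k) (ds k))) 0) par own ∧
      ∃ d : Fin n, par (other F H (sr k) (ds k)) = d := by
  obtain ⟨a, v, ha, hv, hav⟩ := harcs.adj k hk
  rw [ha] at h1 hK ho hd
  rw [hv] at h2 hp hK' ho hd
  rw [ha, hv]
  obtain ⟨w, hw, hvw⟩ := h.adj_par h2 hp
  rw [hw] at hp hK' ho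
  obtain ⟨c, hc, hxc, hcw⟩ := h.own_spec w hp
  rw [hc] at hK' ho
  obtain ⟨u, huv, hu, hN⟩ :=
    (hcnt a h1).eq_of_two hK (v := v) (harcs.mem_liveNbrs.2 ⟨hle h2, hav⟩)
  obtain ⟨u', huw, hu', hN'⟩ := (hcnt c ((hA c).2 hxc)).eq_of_two hK' (v := w)
    (harcs.mem_liveNbrs.2 ⟨hle hp, hcw⟩)
  obtain rfl : u = u' := Fin.ext (by rw [← hu, ho, hu'])
  rw [hu] at hd ⊢
  -- `u` may have been deleted earlier in this round, so its pointer is controlled by `hle'`, at the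
  -- start of the round.
  have hu₀ : u ∈ live n al₀ := (harcs.mem_liveNbrs.1 (hN ▸ Finset.mem_insert_self u _)).1
  obtain ⟨d, hd', hud⟩ : ∃ d : Fin n, par u = d ∧ G.Adj u d := by
    rcases hle' u hu₀ with hx | hw
    · exact absurd (hx ▸ h.al_x) hd
    · exact hw
  rw [hd']
  refine ⟨h.kill fun hs => Solvable.kill_resolve hs hle ((hA a).1 h1) hxc (u := u) (v := v) (w := w)
    ?_ ?_ hvw hud, d, rfl⟩
  · intro b hb hab
    have : b ∈ liveNbrs sr ds M al₀ a := harcs.mem_liveNbrs.2 ⟨hb, hab⟩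
    simpa [hN] using this
  · intro b hb hab
    have : b ∈ liveNbrs sr ds M al₀ c := harcs.mem_liveNbrs.2 ⟨hb, hab⟩
    simpa [hN'] using this

/-- All arcs being processed, every live neighbour of a live vertex equals its pointer, which gives
the matching; `ClosedAt` supplies the two closure conditions. -/
theorem Core.solvable_of_closed (h6 : (cycleGraph 6).Free G) (h7 : (cycleGraph 7).Free G)
    (harcs : Arcs G M sr ds) (h : Core G x sr ds M al par own)
    (hA : ∀ v : Fin n, A v ≠ 0 ↔ G.Adj x v)
    (hcnt : ∀ a : Fin n, A a ≠ 0 → Counted K F H a (liveNbrs sr ds M al a))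
    (hcl : ∀ e < M, ClosedAt sr ds A K F H al par own e)
    (hne : ∀ a : Fin n, A a ≠ 0 → K a ≠ 0) : G.Solvable x (live n al) := by
  have hpar : ∀ c ∈ live n al, ∀ b ∈ live n al, G.Adj c b → par c = b := by
    intro c hc b hb hcb
    obtain ⟨e, he, hs, hd⟩ := harcs.exists_of_adj c b hcb
    rw [← hs, ← hd]
    exact h.arc e he (hs ▸ hc) (hd ▸ hb)
  refine SimpleGraph.solvable_of_closed h6 h7 h.subset ?_ ?_ ?_ ?_
  · intro c hc b hb d hd hcb hcd
    exact Fin.ext ((hpar c hc b hb hcb).symm.trans (hpar c hc d hd hcd))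
  · intro a hxa
    have hAa := (hA a).2 hxa
    have h1 := (hcnt a hAa).card
    have h2 := hne a hAa
    obtain ⟨b, hb⟩ := Finset.card_pos.1 (show 0 < (liveNbrs sr ds M al a).card by omega)
    exact ⟨b, harcs.mem_liveNbrs.1 hb⟩
  · intro a hxa u hu hau huniq d hd hud
    have hAa := (hA a).2 hxa
    have hN : liveNbrs sr ds M al a = {u} := by
      ext b
      rw [harcs.mem_liveNbrs, Finset.mem_singleton]
      exact ⟨fun hb => huniq b hb.1 hb.2, fun hb => hb ▸ ⟨hu, hau⟩⟩
    obtain ⟨e, he, hs, hds⟩ := harcs.exists_of_adj a u hau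
    have := (hcl e he).unit (hs ▸ hAa) (hds ▸ hu) (by rw [hs, (hcnt a hAa).card, hN]; simp)
    rw [hds, hpar u hu d hd hud] at this
    exact hd this
  · intro a c hxa hxc u hu v hv w hw huv huw hau hav haN hcu hcw hcN hown hvw d hd hud
    have hAa := (hA a).2 hxa
    have hAc := (hA c).2 hxc
    have hN : liveNbrs sr ds M al a = {u, v} := by
      ext b
      rw [harcs.mem_liveNbrs, Finset.mem_insert, Finset.mem_singleton]
      exact ⟨fun hb => haN b hb.1 hb.2, by rintro (rfl | rfl); exacts [⟨hu, hau⟩, ⟨hv, hav⟩]⟩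
    have hN' : liveNbrs sr ds M al c = {u, w} := by
      ext b
      rw [harcs.mem_liveNbrs, Finset.mem_insert, Finset.mem_singleton]
      exact ⟨fun hb => hcN b hb.1 hb.2, by rintro (rfl | rfl); exacts [⟨hu, hcu⟩, ⟨hw, hcw⟩]⟩
    have hKa : K a = 2 := by rw [(hcnt a hAa).card, hN, Finset.card_pair huv]; rfl
    have hKc : K c = 2 := by rw [(hcnt c hAc).card, hN', Finset.card_pair huw]; rfl
    obtain ⟨u₁, h1, h2, h3⟩ := (hcnt a hAa).eq_of_two hKa (v := v) (by simp [hN])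
    obtain ⟨u₂, h1', h2', h3'⟩ := (hcnt c hAc).eq_of_two hKc (v := w) (by simp [hN'])
    have hu₁ : u₁ = u := by
      have : u ∈ ({u₁, v} : Finset (Fin n)) := by rw [← h3, hN]; simp
      simpa [huv, eq_comm] using this
    have hu₂ : u₂ = u := by
      have : u ∈ ({u₂, w} : Finset (Fin n)) := by rw [← h3', hN']; simp
      simpa [huw, eq_comm] using this
    subst hu₁ hu₂
    obtain ⟨e, he, hs, hds⟩ := harcs.exists_of_adj a v hav
    -- Uniqueness of the neighbour of `w` in `N(x)` identifies the stored one with `c`.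
    obtain ⟨c', hc', hxc', hcw'⟩ := h.own_spec w hw
    obtain rfl := hown c' hxc' hcw'
    have hpv := hpar v hv w hw hvw
    have := (hcl e he).resolve (hs ▸ hAa) (hds ▸ hv) (by rw [hs, hKa])
      (by rw [hds, hpv]; exact hw) (by rw [hds, hpv, hc', hKc])
      (by rw [hs, hds, hpv, hc', h2, h2'])
    rw [hs, hds, h2, hpar _ hu d hd hud] at this
    exact hd this

end

end RAM

/-! ### The program and its preprocessing phases. -/

namespace RAM

open SimpleGraph

/-! The program keeps `n`, `x`, the number of arcs, `0`, `1`, `2` in registers `0`, `1`, `2`, `3`,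
`12`, `13`. Array `2` holds the sources of the arcs, arrays `3` to `9` hold the marks of the
neighbours of `x`, the marks of the live vertices, `par`, `own`, and the live neighbours of each
neighbour of `x`: a first one, a second one, and their number up to three. -/

infixr:60 " ;; " => Prog.seq

def skip : Prog := .op (.copy 3 3)

/-- Load source and target of the current arc. -/
def fetch : Prog := .op (.load 5 2 4) ;; .op (.load 6 1 4)

/-- Run `p` if array `k` does not vanish at the index in register `i`. -/
def whenMarked (k i : ℕ) (p : Prog) : Prog := .op (.load 7 k i) ;; .branch (.eq 7 3) skip p

def setup : Prog :=
  .op (.load 2 0 0) ;; .op (.const 12 1) ;; .op (.const 13 2) ;; .op (.const 4 0) ;;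
    .op (.const 5 0)

def sourcesBody : Prog :=
  .op (.copy 6 5) ;; .op (.inc 6) ;; .op (.load 7 0 6) ;;
    .branch (.lt 4 7) (.op (.store 2 4 5) ;; .op (.inc 4)) (.op (.inc 5))

def markBody : Prog := fetch ;; .branch (.eq 5 1) (.op (.store 3 6 12)) skip

def secondBody : Prog :=
  fetch ;; whenMarked 3 5 (.op (.load 7 3 6) ;; .branch (.eq 7 3)
    (.branch (.eq 6 1) skip (.op (.store 4 6 12) ;; .op (.store 5 6 1) ;; .op (.store 6 6 5))) skip)

def pruneBody : Prog :=
  fetch ;; whenMarked 4 5 (whenMarked 4 6 (.op (.load 8 5 5) ;; .op (.load 7 4 8) ;;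
    .branch (.eq 7 3) (.op (.store 5 5 6)) (.branch (.eq 8 6) skip (.op (.store 4 6 3)))))

def resetBody : Prog := .op (.store 9 4 3)

def countBody : Prog :=
  fetch ;; whenMarked 3 5 (whenMarked 4 6 (.op (.load 7 9 5) ;; .branch (.eq 7 3)
    (.op (.store 7 5 6) ;; .op (.store 9 5 12))
    (.branch (.eq 7 12) (.op (.store 8 5 6) ;; .op (.store 9 5 13))
      (.op (.const 7 3) ;; .op (.store 9 5 7)))))

/-- Remove the mark of the vertex in register `i` and raise the flag if there was one. -/
def kill (i : ℕ) : Prog := whenMarked 4 i (.op (.store 4 i 3) ;; .op (.const 11 1))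

/-- Load into register `i` the recorded live neighbour of `r_a` that differs from `r_v`. -/
def loadOther (i a v : ℕ) : Prog := .op (.load i 7 a) ;; .branch (.eq i v) (.op (.load i 8 a)) skip

def propagateBody : Prog :=
  fetch ;; whenMarked 3 5 (whenMarked 4 6 (.op (.load 8 5 6) ;; .op (.load 7 9 5) ;;
    .branch (.eq 7 12) (kill 8) (.branch (.eq 7 13)
      (whenMarked 4 8 (.op (.load 9 6 8) ;; .op (.load 7 9 9) ;; .branch (.eq 7 13)
        (loadOther 10 5 6 ;; loadOther 14 9 8 ;; .branch (.eq 10 14)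
          (.op (.load 10 5 10) ;; kill 10) skip) skip)) skip)))

def roundBody : Prog :=
  .op (.const 11 0) ;; forLoop 4 0 resetBody ;; forLoop 4 2 countBody ;; forLoop 4 2 propagateBody

def verdictBody : Prog :=
  whenMarked 3 4 (.op (.load 7 9 4) ;; .branch (.eq 7 3) (.op (.copy 8 12)) skip)

/-- Decides whether the vertex in register `1` is extendable. -/
def extendableProg : Prog :=
  setup ;; .loop (.lt 4 2) sourcesBody ;; forLoop 4 2 markBody ;; forLoop 4 2 secondBody ;;
    forLoop 4 2 pruneBody ;; .op (.const 11 1) ;; .loop (.lt 3 11) roundBody ;;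
    .op (.const 8 0) ;; forLoop 4 0 verdictBody ;; .op (.copy 0 8)

variable {n : ℕ} {G : SimpleGraph (Fin n)} {x : Fin n} {M : ℕ}

structure Ready (G : SimpleGraph (Fin n)) (x : Fin n) (M : ℕ) (s : State) : Prop where
  reg_zero : s.reg 0 = n
  reg_one : s.reg 1 = x
  reg_two : s.reg 2 = M
  reg_three : s.reg 3 = 0
  reg_twelve : s.reg 12 = 1
  reg_thirteen : s.reg 13 = 2
  arcs : Arcs G M (s.arr 2) (s.arr 1)

theorem ready_iff {s : State} : Ready G x M s ↔ s.reg 0 = n ∧ s.reg 1 = x ∧ s.reg 2 = M ∧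
    s.reg 3 = 0 ∧ s.reg 12 = 1 ∧ s.reg 13 = 2 ∧ Arcs G M (s.arr 2) (s.arr 1) :=
  ⟨fun ⟨h0, h1, h2, h3, h4, h5, h6⟩ => ⟨h0, h1, h2, h3, h4, h5, h6⟩,
    fun ⟨h0, h1, h2, h3, h4, h5, h6⟩ => ⟨h0, h1, h2, h3, h4, h5, h6⟩⟩

theorem Ready.congr {s s' : State} (h : Ready G x M s) (h0 : s'.reg 0 = s.reg 0)
    (h1 : s'.reg 1 = s.reg 1) (h2 : s'.reg 2 = s.reg 2) (h3 : s'.reg 3 = s.reg 3)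
    (h12 : s'.reg 12 = s.reg 12) (h13 : s'.reg 13 = s.reg 13) (ha2 : s'.arr 2 = s.arr 2)
    (ha1 : s'.arr 1 = s.arr 1) : Ready G x M s' :=
  ⟨h0.trans h.reg_zero, h1.trans h.reg_one, h2.trans h.reg_two, h3.trans h.reg_three,
    h12.trans h.reg_twelve, h13.trans h.reg_thirteen, by rw [ha2, ha1]; exact h.arcs⟩

theorem Ready.setReg {s : State} (h : Ready G x M s) {i v : ℕ}
    (hi : i ∉ [0, 1, 2, 3, 12, 13]) : Ready G x M (s.setReg i v) := by
  simp only [List.mem_cons, List.not_mem_nil, or_false, not_or] at hi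
  obtain ⟨h0, h1, h2, h3, h12, h13⟩ := hi
  refine h.congr ?_ ?_ ?_ ?_ ?_ ?_ rfl rfl <;>
    exact Function.update_of_ne (Ne.symm ‹_›) _ _

theorem wp_skip {Q : State → Prop} {s : State} : skip.wp Q s ↔ Q s := by
  simp [skip, Prog.wp, Op.apply, State.setReg]

theorem wp_loadOther {Q : State → Prop} {s : State} {i a v : ℕ} (ha : a ≠ i) (hv : v ≠ i) :
    (loadOther i a v).wp Q s ↔
      Q (s.setReg i (other (s.arr 7) (s.arr 8) (s.reg a) (s.reg v))) := by
  by_cases h : s.arr 7 (s.reg a) = s.reg v <;>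
  simp [loadOther, Prog.wp, wp_skip, Op.apply, State.setReg, Test.Holds, other, ha, hv, h]

theorem within_mark {s : State} (hR : Ready G x M s) (h3 : ∀ j, s.arr 3 j = 0)
    (h4 : ∀ j, s.arr 4 j = 0) :
    Within (forLoop 4 2 markBody) s ((markBody.cost + 2) * M + 2) fun s =>
      Ready G x M s ∧ (∀ j, s.arr 4 j = 0) ∧ ∀ v : Fin n, s.arr 3 v ≠ 0 ↔ G.Adj x v := by
  refine (within_forLoop (fun k s => Ready G x M s ∧ (∀ j, s.arr 4 j = 0) ∧
    ∀ v : Fin n, s.arr 3 v ≠ 0 ↔ ∃ e < k, s.arr 2 e = x ∧ s.arr 1 e = v)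
    hR.reg_two (by decide) ?_ ?_).mono le_rfl ?_
  · exact ⟨hR.setReg (by decide), h4, fun v => by simp [State.setReg, h3]⟩
  · rintro k hk s hi hj ⟨hR, h4, hA⟩
    obtain ⟨h0, h1, -, h3, h12, h13, harcs⟩ := ready_iff.1 hR
    obtain ⟨u, w, hu, hw, huw⟩ := harcs.adj k hk
    simp only [markBody, fetch, wp_skip, Prog.wp, Op.apply, Test.Holds, State.setReg,
      State.setArr, ready_iff, hi, hj, h0, h1, h3, h12, h13, Function.update_apply,
      Nat.reduceEqDiff, if_true, if_false, true_and, implies_true, harcs, h4, hu, hw]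
    have key : ∀ v : Fin n, (∃ e < k + 1, s.arr 2 e = x ∧ s.arr 1 e = v) ↔
        (u = x ∧ v = w) ∨ ∃ e < k, s.arr 2 e = x ∧ s.arr 1 e = v := by
      intro v
      simp only [Nat.lt_succ_iff_lt_or_eq, or_and_right, exists_or, exists_eq_left, hu, hw,
        ← Fin.ext_iff, eq_comm (a := v)]
      exact or_comm
    simp only [key, hA, ← Fin.ext_iff]
    constructor
    · rintro rfl v
      split_ifs with h
      · simp [h]
      · simp [h, hA]
    · intro h v
      simp [h]
  · rintro s ⟨hR, h4, hA⟩
    refine ⟨hR, h4, fun v => (hA v).trans ⟨?_, hR.arcs.exists_of_adj x v⟩⟩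
    rintro ⟨e, he, hs, hd⟩
    obtain ⟨u, w, hu, hw, huw⟩ := hR.arcs.adj e he
    rw [Fin.ext (hs.symm.trans hu), Fin.ext (hd.symm.trans hw)]
    exact huw

/-- Pointers start at `x`, which is never live and so serves as a null pointer. -/
theorem within_second {s : State} (hR : Ready G x M s)
    (h4 : ∀ j, s.arr 4 j = 0) (hA : ∀ v : Fin n, s.arr 3 v ≠ 0 ↔ G.Adj x v) :
    Within (forLoop 4 2 secondBody) s ((secondBody.cost + 2) * M + 2) fun s =>
      Ready G x M s ∧ (∀ v : Fin n, s.arr 3 v ≠ 0 ↔ G.Adj x v) ∧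
      Core G x (s.arr 2) (s.arr 1) 0 (s.arr 4) (s.arr 5) (s.arr 6) := by
  refine (within_forLoop (fun k s => Ready G x M s ∧ (∀ v : Fin n, s.arr 3 v ≠ 0 ↔ G.Adj x v) ∧
    (∀ v : Fin n, s.arr 4 v ≠ 0 → s.arr 5 v = x ∧ v ∈ G.nbhd 2 x ∧
      ∃ a : Fin n, s.arr 6 v = a ∧ G.Adj x a ∧ G.Adj a v) ∧
    ∀ v : Fin n, v ∈ G.nbhd 2 x → ∀ e < k, s.arr 3 (s.arr 2 e) ≠ 0 → s.arr 1 e = v → s.arr 4 v ≠ 0)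
    hR.reg_two (by decide) ?_ ?_).mono le_rfl ?_
  · exact ⟨hR.setReg (by decide), hA, fun v hv => absurd (h4 v) hv, by simp⟩
  · rintro k hk s hi hj ⟨hR, hA, hB, hC⟩
    obtain ⟨h0, h1, -, h3, h12, h13, harcs⟩ := ready_iff.1 hR
    obtain ⟨u, w, hu, hw, huw⟩ := harcs.adj k hk
    simp only [secondBody, whenMarked, fetch, wp_skip, Prog.wp, Op.apply, Test.Holds, State.setReg,
      State.setArr, ready_iff, hi, hj, h0, h1, h3, h12, h13, Function.update_apply,
      Nat.reduceEqDiff, if_true, if_false, true_and, harcs, hu, hw]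
    have key : (s.arr 3 u ≠ 0 → w ∈ G.nbhd 2 x → s.arr 4 w ≠ 0) →
        ∀ v : Fin n, v ∈ G.nbhd 2 x → ∀ e < k + 1, s.arr 3 (s.arr 2 e) ≠ 0 → s.arr 1 e = v →
          s.arr 4 v ≠ 0 := by
      intro h v hv e he h1 h2
      rcases Nat.lt_succ_iff_lt_or_eq.1 he with he | rfl
      · exact hC v hv e he h1 h2
      · rw [hu] at h1
        obtain rfl : w = v := Fin.ext (hw.symm.trans h2)
        exact h h1 hv
    refine ⟨fun h => ⟨hA, hB, key fun h' => absurd h h'⟩, fun h => ⟨fun hw3 => ⟨fun hwx =>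
      ⟨hA, hB, key ?_⟩, fun hwx => ⟨hA, ?_, ?_⟩⟩, fun hw3 => ⟨hA, hB, key ?_⟩⟩⟩
    · intro _ hn
      exact absurd (Fin.ext hwx) (mem_nbhd_two.1 hn).1
    · intro v
      simp only [← Fin.ext_iff]
      split_ifs with hvw
      · subst hvw
        refine fun _ => ⟨rfl, mem_nbhd_two.2 ⟨fun h => hwx (congrArg _ h), fun h => ?_, u,
          (hA u).1 h, huw⟩, u, rfl, (hA u).1 h, huw⟩
        exact (hA v).2 h hw3
      · exact hB v
    · intro v hv e he h1 h2
      simp only [← Fin.ext_iff]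
      split_ifs with hvw
      · simp
      · rcases Nat.lt_succ_iff_lt_or_eq.1 he with he | rfl
        · exact hC v hv e he h1 h2
        · exact absurd (Fin.ext (h2.symm.trans hw)) hvw
    · intro _ hn
      exact absurd ((hA w).1 hw3) (mem_nbhd_two.1 hn).2.1
  · rintro s ⟨hR, hA, hB, hC⟩
    have hlive : live n (s.arr 4) = G.nbhd 2 x := by
      ext v
      refine ⟨fun hv => (hB v hv).2.1, fun hv => ?_⟩
      obtain ⟨a, hxa, hav⟩ := (mem_nbhd_two.1 hv).2.2
      obtain ⟨e, he, hs, hd⟩ := hR.arcs.exists_of_adj a v hav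
      exact hC v hv e he (hs ▸ (hA a).2 hxa) hd
    exact ⟨hR, hA, hlive.le, fun h => hlive ▸ h, fun v hv => Or.inl (hB v hv).1,
      fun v hv => (hB v hv).2.2, by simp⟩

theorem within_prune (h6 : (cycleGraph 6).Free G) (h7 : (cycleGraph 7).Free G) {s : State}
    (hR : Ready G x M s) (hA : ∀ v : Fin n, s.arr 3 v ≠ 0 ↔ G.Adj x v)
    (hC : Core G x (s.arr 2) (s.arr 1) 0 (s.arr 4) (s.arr 5) (s.arr 6)) :
    Within (forLoop 4 2 pruneBody) s ((pruneBody.cost + 2) * M + 2) fun s =>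
      Ready G x M s ∧ (∀ v : Fin n, s.arr 3 v ≠ 0 ↔ G.Adj x v) ∧
      Core G x (s.arr 2) (s.arr 1) M (s.arr 4) (s.arr 5) (s.arr 6) := by
  refine within_forLoop (fun k s => Ready G x M s ∧ (∀ v : Fin n, s.arr 3 v ≠ 0 ↔ G.Adj x v) ∧
      Core G x (s.arr 2) (s.arr 1) k (s.arr 4) (s.arr 5) (s.arr 6)) hR.reg_two (by decide) ?_ ?_
  · exact ⟨hR.setReg (by decide), hA, hC⟩
  · rintro k hk s hi hj ⟨hR, hA, hC⟩
    obtain ⟨h0, h1, -, h3, h12, h13, harcs⟩ := ready_iff.1 hR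
    simp only [pruneBody, fetch, whenMarked, wp_skip, Prog.wp, Op.apply, Test.Holds, State.setReg,
      State.setArr, ready_iff, hi, hj, h0, h1, h3, h12, h13, Function.update_apply,
      Nat.reduceEqDiff, if_true, if_false, true_and, harcs]
    refine ⟨fun h => ⟨hA, hC.succ_of_dead (Or.inl h)⟩, fun hu => ⟨fun h =>
      ⟨hA, hC.succ_of_dead (Or.inr (Or.inl h))⟩, fun hw => ⟨fun h =>
      ⟨hA, hC.succ_of_setPar harcs hk h⟩, fun hp => ⟨fun h =>
      ⟨hA, hC.succ_of_dead (Or.inr (Or.inr h))⟩, fun h =>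
      ⟨hA, hC.succ_of_kill h6 h7 harcs hk hu hw hp h⟩⟩⟩⟩⟩

end RAM

/-! ### Propagation rounds and the verdict. -/

namespace RAM

open SimpleGraph

variable {n : ℕ} {G : SimpleGraph (Fin n)} {x : Fin n} {M : ℕ}

theorem within_reset {s : State} (hR : Ready G x M s) {A al par own : ℕ → ℕ} (h11 : s.reg 11 = 0)
    (hA : s.arr 3 = A) (hal : s.arr 4 = al) (hpar : s.arr 5 = par) (hown : s.arr 6 = own)
    (hcore : Core G x (s.arr 2) (s.arr 1) M al par own) :
    Within (forLoop 4 0 resetBody) s ((resetBody.cost + 2) * n + 2) fun s =>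
      Ready G x M s ∧ s.reg 11 = 0 ∧ s.arr 3 = A ∧ s.arr 4 = al ∧ s.arr 5 = par ∧
      s.arr 6 = own ∧ Core G x (s.arr 2) (s.arr 1) M al par own ∧ ∀ v : Fin n, s.arr 9 v = 0 := by
  refine (within_forLoop (fun k s => Ready G x M s ∧ s.reg 11 = 0 ∧ s.arr 3 = A ∧ s.arr 4 = al ∧
    s.arr 5 = par ∧ s.arr 6 = own ∧ Core G x (s.arr 2) (s.arr 1) M al par own ∧ ∀ j < k, s.arr 9 j = 0)
    hR.reg_zero (by decide) ?_ ?_).mono le_rfl ?_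
  · exact ⟨hR.setReg (by decide), h11, hA, hal, hpar, hown, hcore, by simp⟩
  · rintro k hk s hi hj ⟨hR, h11, hA, hal, hpar, hown, hcore, h9⟩
    obtain ⟨h0, h1, h2, h3, h12, h13, harcs⟩ := ready_iff.1 hR
    simp only [resetBody, Prog.wp, Op.apply, State.setReg,
      State.setArr, ready_iff, hi, h0, h1, h2, h3, h11, h12, h13, Function.update_apply,
      Nat.reduceEqDiff, if_true, if_false, true_and, harcs, hA, hal, hpar, hown, hcore]
    intro j hjk
    split_ifs with h
    · rfl
    · exact h9 j (by omega)
  · rintro s ⟨hR, h11, hA, hal, hpar, hown, hcore, h9⟩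
    exact ⟨hR, h11, hA, hal, hpar, hown, hcore, fun v => h9 v v.2⟩

theorem within_count {s : State} (hR : Ready G x M s) {A al par own : ℕ → ℕ} (h11 : s.reg 11 = 0)
    (hA : s.arr 3 = A) (hal : s.arr 4 = al) (hpar : s.arr 5 = par) (hown : s.arr 6 = own)
    (hcore : Core G x (s.arr 2) (s.arr 1) M al par own) (h9 : ∀ v : Fin n, s.arr 9 v = 0) :
    Within (forLoop 4 2 countBody) s ((countBody.cost + 2) * M + 2) fun s =>
      Ready G x M s ∧ s.reg 11 = 0 ∧ s.arr 3 = A ∧ s.arr 4 = al ∧ s.arr 5 = par ∧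
      s.arr 6 = own ∧ Core G x (s.arr 2) (s.arr 1) M al par own ∧ ∀ a : Fin n, A a ≠ 0 →
        Counted (s.arr 9) (s.arr 7) (s.arr 8) a (liveNbrs (s.arr 2) (s.arr 1) M al a) := by
  refine within_forLoop (fun k s => Ready G x M s ∧ s.reg 11 = 0 ∧ s.arr 3 = A ∧ s.arr 4 = al ∧
    s.arr 5 = par ∧ s.arr 6 = own ∧ Core G x (s.arr 2) (s.arr 1) M al par own ∧ ∀ a : Fin n, A a ≠ 0 →
      Counted (s.arr 9) (s.arr 7) (s.arr 8) a (liveNbrs (s.arr 2) (s.arr 1) k al a))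
    hR.reg_two (by decide) ?_ ?_
  · refine ⟨hR.setReg (by decide), h11, hA, hal, hpar, hown, hcore, fun a _ => ?_⟩
    have hN : ∀ sr ds, liveNbrs sr ds 0 al a = ∅ := fun sr ds => by
      ext v; simp [mem_liveNbrs]
    rw [hN]
    exact ⟨by simpa [State.setReg] using h9 a, by simp, by simp⟩
  · rintro k hk s hi hj ⟨hR, h11, hA, hal, hpar, hown, hcore, hC⟩
    obtain ⟨h0, h1, -, h3, h12, h13, harcs⟩ := ready_iff.1 hR
    obtain ⟨u, w, hu, hw, huw⟩ := harcs.adj k hk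
    simp only [countBody, whenMarked, fetch, wp_skip, Prog.wp, Op.apply, Test.Holds, State.setReg,
      State.setArr, ready_iff, hi, hj, h0, h1, h3, h11, h12, h13, Function.update_apply,
      Nat.reduceEqDiff, if_true, if_false, true_and, harcs, hA, hal, hpar, hown, hcore]
    have hold : ∀ a : Fin n, u ≠ a ∨ al w = 0 → A a ≠ 0 → Counted (s.arr 9) (s.arr 7) (s.arr 8) a
        (liveNbrs (s.arr 2) (s.arr 1) (k + 1) al a) := by
      intro a ha haA
      rw [liveNbrs_succ_of_ne]
      · exact hC a haA
      · rw [hu, hw]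
        exact ha.imp_left fun h h' => h (Fin.ext h')
    rw [hu, hw]
    refine ⟨fun h a ha => hold a (Or.inl ?_) ha, fun hAu => ⟨fun h a ha => hold a (Or.inr h) ha,
      fun hw0 => ?_⟩⟩
    · rintro rfl
      exact ha h
    have hne : ∀ {a : Fin n}, a ≠ u → (a : ℕ) ≠ u := fun h h' => h (Fin.ext h')
    obtain ⟨hwN, hins⟩ := liveNbrs_succ harcs hk hu hw hw0
    refine ⟨fun hK a ha => ?_, fun hK => ⟨fun hK1 a ha => ?_, fun hK1 a ha => ?_⟩⟩ <;>
      rcases eq_or_ne a u with rfl | hau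
    · rw [hins]
      exact (hC a hAu).insert_first hwN hK
    · exact (hold a (Or.inl hau.symm) ha).congr (by simp [hne hau]) (by simp [hne hau]) rfl
    · rw [hins]
      exact (hC a hAu).insert_second hwN hK1
    · exact (hold a (Or.inl hau.symm) ha).congr (by simp [hne hau]) rfl (by simp [hne hau])
    · rw [hins]
      exact (hC a hAu).insert_more hwN hK hK1
    · exact (hold a (Or.inl hau.symm) ha).congr (by simp [hne hau]) rfl rfl

/-- The state of affairs after propagation along the first `k` arcs, which started with `al₀`;
`flag` tells whether a mark has been removed. -/
def Propagated (G : SimpleGraph (Fin n)) (x : Fin n) (M : ℕ) (sr ds A K F H al₀ par own : ℕ → ℕ)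
    (k : ℕ) (al : ℕ → ℕ) (flag : ℕ) : Prop :=
  Core G x sr ds M al par own ∧ live n al ⊆ live n al₀ ∧
    (flag = 0 ∧ al = al₀ ∧ (∀ e < k, ClosedAt sr ds A K F H al par own e) ∨
      flag = 1 ∧ live n al ≠ live n al₀)

theorem Propagated.keep {sr ds A K F H al₀ par own al : ℕ → ℕ} {k flag : ℕ}
    (h : Propagated G x M sr ds A K F H al₀ par own k al flag)
    (hk : ClosedAt sr ds A K F H al par own k) :
    Propagated G x M sr ds A K F H al₀ par own (k + 1) al flag := by
  obtain ⟨hC, hle, ⟨hf, hal, hcl⟩ | h⟩ := h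
  · refine ⟨hC, hle, Or.inl ⟨hf, hal, fun e he => ?_⟩⟩
    rcases Nat.lt_succ_iff_lt_or_eq.1 he with he | rfl
    exacts [hcl e he, hk]
  · exact ⟨hC, hle, Or.inr h⟩

theorem Propagated.kill {sr ds A K F H al₀ par own al : ℕ → ℕ} {k flag d : ℕ}
    (h : Propagated G x M sr ds A K F H al₀ par own k al flag)
    (hC : Core G x sr ds M (Function.update al d 0) par own ∧ ∃ d' : Fin n, d = d')
    (hd : al d ≠ 0) :
    Propagated G x M sr ds A K F H al₀ par own (k + 1) (Function.update al d 0) 1 := by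
  obtain ⟨hC, d, rfl⟩ := hC
  refine ⟨hC, ?_, Or.inr ⟨rfl, fun heq => ?_⟩⟩
  · rw [live_update_zero]
    exact Set.sdiff_subset.trans h.2.1
  · have : d ∈ live n al₀ := h.2.1 hd
    rw [← heq, live_update_zero] at this
    exact this.2 rfl

theorem within_propagate {s : State} (hR : Ready G x M s) {A al₀ par own : ℕ → ℕ}
    (hmark : ∀ v : Fin n, A v ≠ 0 ↔ G.Adj x v)
    (hcore : Core G x (s.arr 2) (s.arr 1) M al₀ par own) (h11 : s.reg 11 = 0)
    (hA : s.arr 3 = A) (hal : s.arr 4 = al₀) (hpar : s.arr 5 = par) (hown : s.arr 6 = own)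
    (hcnt : ∀ a : Fin n, A a ≠ 0 →
      Counted (s.arr 9) (s.arr 7) (s.arr 8) a (liveNbrs (s.arr 2) (s.arr 1) M al₀ a)) :
    Within (forLoop 4 2 propagateBody) s ((propagateBody.cost + 2) * M + 2) fun s =>
      Ready G x M s ∧ s.arr 3 = A ∧ s.arr 5 = par ∧ s.arr 6 = own ∧
      (∀ a : Fin n, A a ≠ 0 →
        Counted (s.arr 9) (s.arr 7) (s.arr 8) a (liveNbrs (s.arr 2) (s.arr 1) M al₀ a)) ∧
      Propagated G x M (s.arr 2) (s.arr 1) A (s.arr 9) (s.arr 7) (s.arr 8) al₀ par own M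
        (s.arr 4) (s.reg 11) := by
  refine within_forLoop (fun k s => Ready G x M s ∧ s.arr 3 = A ∧ s.arr 5 = par ∧ s.arr 6 = own ∧
      (∀ a : Fin n, A a ≠ 0 →
        Counted (s.arr 9) (s.arr 7) (s.arr 8) a (liveNbrs (s.arr 2) (s.arr 1) M al₀ a)) ∧
      Propagated G x M (s.arr 2) (s.arr 1) A (s.arr 9) (s.arr 7) (s.arr 8) al₀ par own k
        (s.arr 4) (s.reg 11)) hR.reg_two (by decide) ?_ ?_
  · refine ⟨hR.setReg (by decide), hA, hpar, hown, hcnt, ?_⟩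
    simp only [State.setReg, hal]
    exact ⟨hcore, le_rfl, Or.inl ⟨by simpa using h11, rfl, by simp⟩⟩
  · rintro k hk s hi hj ⟨hR, hA, hpar, hown, hcnt, hP⟩
    have hle : ∀ v ∈ live n al₀, par v = x ∨ ∃ w : Fin n, par v = w ∧ G.Adj v w := hcore.par_spec
    obtain ⟨h0, h1, -, h3, h12, h13, harcs⟩ := ready_iff.1 hR
    simp only [propagateBody, kill, whenMarked, fetch, wp_skip, Prog.wp, wp_loadOther, Op.apply,
      Test.Holds, State.setReg, ne_eq, not_false_iff,
      State.setArr, ready_iff, hi, hj, h0, h1, h3, h12, h13, Function.update_apply,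
      Nat.reduceEqDiff, if_true, if_false, true_and, harcs, hA, hpar, hown]
    -- One case per branch of the body. Outside the two deleting branches, the test outcomes refute
    -- a premise of each clause of `ClosedAt` or give its conclusion.
    refine ⟨fun hA0 => ⟨hcnt, hP.keep ⟨by tauto, by tauto⟩⟩, fun hA0 => ⟨fun hv =>
      ⟨hcnt, hP.keep ⟨by tauto, by tauto⟩⟩, fun hv => ⟨fun hK => ⟨fun hp => ⟨hcnt, hP.keep
      ⟨fun _ _ _ => hp, fun _ _ _ h => absurd hp h⟩⟩, fun hp => ⟨hcnt, hP.kill (hP.1.kill_unit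
      harcs hP.2.1 hmark hcnt hk hA0 hv hK hp) hp⟩⟩, fun hK1 => ⟨fun hK => ⟨fun hp => ⟨hcnt,
      hP.keep ⟨by tauto, by tauto⟩⟩, fun hp => ⟨fun hK' => ⟨fun ho => ⟨fun hd => ⟨hcnt,
      hP.keep ⟨by tauto, by tauto⟩⟩, fun hd => ⟨hcnt, hP.kill (hP.1.kill_resolve harcs hP.2.1
      hmark hcnt hle hk hA0 hv hK hp hK' ho hd) hd⟩⟩, fun ho => ⟨hcnt, hP.keep
      ⟨by tauto, by tauto⟩⟩⟩, fun hK' => ⟨hcnt, hP.keep ⟨by tauto, by tauto⟩⟩⟩⟩, fun hK =>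
      ⟨hcnt, hP.keep ⟨by tauto, by tauto⟩⟩⟩⟩⟩⟩

/-- The invariant of the main loop. -/
def RoundInv (G : SimpleGraph (Fin n)) (x : Fin n) (M : ℕ) (s : State) : Prop :=
  Ready G x M s ∧ (∀ v : Fin n, s.arr 3 v ≠ 0 ↔ G.Adj x v) ∧
    Core G x (s.arr 2) (s.arr 1) M (s.arr 4) (s.arr 5) (s.arr 6) ∧
    (s.reg 11 = 1 ∨ s.reg 11 = 0 ∧
      (∀ a : Fin n, s.arr 3 a ≠ 0 → Counted (s.arr 9) (s.arr 7) (s.arr 8) a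
        (liveNbrs (s.arr 2) (s.arr 1) M (s.arr 4) a)) ∧
      ∀ e < M, ClosedAt (s.arr 2) (s.arr 1) (s.arr 3) (s.arr 9) (s.arr 7) (s.arr 8) (s.arr 4)
        (s.arr 5) (s.arr 6) e)

/-- Either a live vertex is lost and the flag is still `1`, or nothing changes and the flag drops to
`0`; the number of live vertices plus the flag decreases in both cases. In the second case the
counts are still exact for the current marks. -/
theorem within_round {s : State} (hI : RoundInv G x M s) (hs : (Test.lt 3 11).Holds s) :
    Within roundBody s (100 * (n + M + 1)) fun s' => RoundInv G x M s' ∧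
      (live n (s'.arr 4)).ncard + s'.reg 11 < (live n (s.arr 4)).ncard + s.reg 11 := by
  obtain ⟨hR, hA, hC, hflag⟩ := hI
  have hs : s.reg 3 < s.reg 11 := hs
  have h11 : s.reg 11 = 1 := by
    rcases hflag with h | h
    · exact h
    · omega
  have hc1 : resetBody.cost = 1 := rfl
  have hc2 : countBody.cost ≤ 40 := by decide
  have hc3 : propagateBody.cost ≤ 50 := by decide
  refine (Within.seq (T₁ := 1) (T₂ := (resetBody.cost + 2) * n + 2 +
    ((countBody.cost + 2) * M + 2 + ((propagateBody.cost + 2) * M + 2)))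
    (R := fun t => t = s.setReg 11 0) ⟨1, _, .op _ _, le_rfl, rfl⟩ ?_).mono
    (by rw [hc1]; nlinarith) fun _ h => h
  rintro t rfl
  refine Within.seq (within_reset (hR.setReg (by decide)) (by simp [State.setReg])
    rfl rfl rfl rfl hC) ?_
  rintro t ⟨hR, h11', hA', hal, hpar, hown, hC, h9⟩
  refine Within.seq (within_count hR h11' hA' hal hpar hown hC h9) ?_
  rintro t ⟨hR, h11', hA', hal, hpar, hown, hC, hcnt⟩
  refine (within_propagate hR hA hC h11' hA' hal hpar hown hcnt).mono le_rfl ?_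
  rintro t ⟨hR, hA', hpar, hown, hcnt, hC, hle, hflag⟩
  simp only [State.setReg] at hA' hpar hown hC hle hflag hcnt
  refine ⟨⟨hR, by rw [hA']; exact hA, by rw [hpar, hown]; exact hC, ?_⟩, ?_⟩
  · rw [hA', hpar, hown]
    rcases hflag with ⟨hf, hal, hcl⟩ | ⟨hf, -⟩
    · exact Or.inr ⟨hf, by rw [hal]; exact hcnt, hcl⟩
    · exact Or.inl hf
  · rw [h11]
    rcases hflag with ⟨hf, hal, hcl⟩ | ⟨hf, hne⟩
    · rw [hf, hal]; omega
    · rw [hf]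
      have := Set.ncard_lt_ncard (hle.ssubset_of_ne hne) (Set.toFinite _)
      omega

/-- A neighbour of `x` with count zero refutes solvability, which all deletions have preserved; if
there is none, `Core.solvable_of_closed` applies. -/
theorem within_verdict (h6 : (cycleGraph 6).Free G) (h7 : (cycleGraph 7).Free G) {s : State}
    (hI : RoundInv G x M s) (h11 : s.reg 11 = 0) :
    Within (.op (.const 8 0) ;; forLoop 4 0 verdictBody ;; .op (.copy 0 8)) s (40 * (n + 1))
      fun s' => (G.IsExtendable x → s'.reg 0 = 1) ∧ (¬ G.IsExtendable x → s'.reg 0 = 0) := by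
  obtain ⟨hR, hA, hC, hflag⟩ := hI
  obtain ⟨-, hcnt, hcl⟩ : _ ∧ _ := hflag.resolve_left (by omega)
  have hc : verdictBody.cost ≤ 10 := by decide
  refine (Within.seq (T₁ := 1) (T₂ := 12 * n + 2 + 1)
    (R := fun t => t = s.setReg 8 0) ⟨1, _, .op _ _, le_rfl, rfl⟩ ?_).mono
    (by omega) fun _ h => h
  rintro t rfl
  refine Within.seq ((within_forLoop (N := n) (fun k t => t.reg 3 = 0 ∧ t.reg 12 = 1 ∧
    t.arr 3 = s.arr 3 ∧ t.arr 9 = s.arr 9 ∧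
    (t.reg 8 = 0 ∧ (∀ v : Fin n, (v : ℕ) < k → s.arr 3 v ≠ 0 → s.arr 9 v ≠ 0) ∨
      t.reg 8 = 1 ∧ ∃ v : Fin n, s.arr 3 v ≠ 0 ∧ s.arr 9 v = 0))
      (by simpa [State.setReg] using hR.reg_zero) (by decide) ?_ ?_).mono
      (by gcongr; omega) fun _ h => h) ?_
  · exact ⟨by simpa [State.setReg] using hR.reg_three, by simpa [State.setReg] using hR.reg_twelve,
      rfl, rfl, Or.inl ⟨by simp [State.setReg], by simp⟩⟩
  · rintro k hk t hi hj ⟨h3, h12, hA', hK, h8⟩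
    have key : (∀ v : Fin n, (v : ℕ) < k → s.arr 3 v ≠ 0 → s.arr 9 v ≠ 0) →
        (s.arr 3 k ≠ 0 → s.arr 9 k ≠ 0) →
        ∀ v : Fin n, (v : ℕ) < k + 1 → s.arr 3 v ≠ 0 → s.arr 9 v ≠ 0 := by
      intro h h' v hv
      rcases Nat.lt_succ_iff_lt_or_eq.1 hv with hv | hv
      · exact h v hv
      · rw [hv]; exact h'
    simp only [verdictBody, whenMarked, wp_skip, Prog.wp, Op.apply, Test.Holds, State.setReg,
      hi, hj, h3, h12, Function.update_apply,
      Nat.reduceEqDiff, if_true, if_false, true_and, hA', hK]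
    refine ⟨fun h0 => ?_, fun h0 => ⟨fun hk0 => ?_, fun hk0 => ?_⟩⟩
    · exact h8.imp_left fun h => ⟨h.1, key h.2 fun h => absurd h0 h⟩
    · exact Or.inr ⟨⟨k, hk⟩, h0, hk0⟩
    · exact h8.imp_left fun h => ⟨h.1, key h.2 fun _ => hk0⟩
  · rintro t ⟨-, -, -, -, h8⟩
    refine ⟨1, _, .op _ _, le_rfl, ?_⟩
    have hres : ((Op.copy 0 8).apply t).reg 0 = t.reg 8 := by simp [Op.apply, State.setReg]
    dsimp only
    rw [hres]
    rcases h8 with ⟨h8, hne⟩ | ⟨h8, v, hv, hv0⟩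
    · have : ¬ G.IsExtendable x := not_isExtendable_iff.2 ((hC.solvable_of_closed h6 h7 hR.arcs hA
        hcnt hcl fun a => hne a a.2).mono hC.subset)
      exact ⟨fun h => absurd h this, fun _ => h8⟩
    · have : G.IsExtendable x := by
        by_contra h
        obtain ⟨S, hS, -, hdom⟩ := hC.solvable (not_isExtendable_iff.1 h)
        obtain ⟨b, hb, hvb⟩ := hdom v ((hA v).1 hv)
        have h1 : b ∈ liveNbrs (s.arr 2) (s.arr 1) M (s.arr 4) v :=
          hR.arcs.mem_liveNbrs.2 ⟨hS hb, hvb⟩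
        have h2 := Finset.card_pos.2 ⟨b, h1⟩
        have h3 := (hcnt v hv).card
        omega
      exact ⟨fun _ => h8, fun h => absurd this h⟩

end RAM

/-! ### Reading the adjacency lists and the total running time. -/

namespace RAM

open SimpleGraph

variable {n : ℕ} {G : SimpleGraph (Fin n)} {x : Fin n}

theorem IsInput.border_le {s : State} (h : IsInput G x s) {i j : ℕ} (hij : i ≤ j) (hj : j ≤ n) :
    s.arr 0 i ≤ s.arr 0 j := by
  induction j, hij using Nat.le_induction with
  | base => exact le_rfl
  | succ j hij ih => exact (ih (by omega)).trans (h.border_mono ⟨j, hj⟩)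

theorem IsInput.eq_of_mem {s : State} (h : IsInput G x s) {u v : Fin n} {e : ℕ}
    (hu : e ∈ Set.Ico (s.arr 0 u) (s.arr 0 ((u : ℕ) + 1)))
    (hv : e ∈ Set.Ico (s.arr 0 v) (s.arr 0 ((v : ℕ) + 1))) : u = v := by
  by_contra hne
  rcases lt_or_gt_of_ne (fun h => hne (Fin.ext h)) with hlt | hlt
  · have := h.border_le (i := u + 1) hlt v.2.le
    have h1 := hu.2
    have h2 := hv.1
    omega
  · have := h.border_le (i := v + 1) hlt u.2.le
    have h1 := hv.2
    have h2 := hu.1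
    omega

theorem IsInput.arcs {s : State} (h : IsInput G x s) {sr : ℕ → ℕ}
    (hsr : ∀ e < s.arr 0 n, ∃ u : Fin n, sr e = u ∧
      e ∈ Set.Ico (s.arr 0 u) (s.arr 0 ((u : ℕ) + 1))) :
    Arcs G (s.arr 0 n) sr (s.arr 1) := by
  refine ⟨fun e he => ?_, fun u w huw => ?_, fun e he e' he' h1 h2 => ?_⟩
  · obtain ⟨u, hu, hmem⟩ := hsr e he
    obtain ⟨w, hw, hwe⟩ := (h.nbrs u).mapsTo hmem
    exact ⟨u, w, hu, hwe.symm, hw⟩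
  · obtain ⟨e, he, hew⟩ := (h.nbrs u).surjOn ⟨w, huw, rfl⟩
    have hlt : e < s.arr 0 n := he.2.trans_le (h.border_le u.2 le_rfl)
    obtain ⟨u', hu', hmem⟩ := hsr e hlt
    rw [h.eq_of_mem hmem he] at hu'
    exact ⟨e, hlt, hu', hew⟩
  · obtain ⟨u, hu, hmem⟩ := hsr e he
    obtain ⟨u', hu', hmem'⟩ := hsr e' he'
    obtain rfl : u = u' := Fin.ext (by rw [← hu, h1, hu'])
    exact (h.nbrs u).injOn hmem hmem' h2

/-- The list lengths are the degrees; they telescope, and the handshake lemma applies. -/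
theorem IsInput.border_eq {s : State} (h : IsInput G x s) :
    s.arr 0 n = 2 * G.edgeSet.ncard := by
  classical
  have hdeg : ∀ v : Fin n, s.arr 0 ((v : ℕ) + 1) = s.arr 0 v + G.degree v := by
    intro v
    have h1 := h.border_mono v
    have h2 : (Set.Ico (s.arr 0 v) (s.arr 0 ((v : ℕ) + 1))).ncard = G.degree v := by
      rw [← (h.nbrs v).injOn.ncard_image, (h.nbrs v).image_eq,
        Set.ncard_image_of_injective _ Fin.val_injective, Set.ncard_eq_toFinset_card',
        ← card_neighborFinset_eq_degree]
      rfl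
    rw [Set.ncard_eq_toFinset_card', Set.toFinset_Ico, Nat.card_Ico] at h2
    omega
  have hsum : s.arr 0 n = ∑ v : Fin n, G.degree v := by
    have h1 : ∑ i ∈ Finset.range n, (s.arr 0 (i + 1) - s.arr 0 i) = s.arr 0 n - s.arr 0 0 := by
      have : ∀ k ≤ n, ∑ i ∈ Finset.range k, (s.arr 0 (i + 1) - s.arr 0 i) + s.arr 0 0
          = s.arr 0 k := by
        intro k hk
        induction k with
        | zero => simp
        | succ k ih =>
          have h1 := ih (by omega)
          have h2 := h.border_mono ⟨k, hk⟩
          rw [Finset.sum_range_succ]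
          simp only at h2
          omega
      have := this n le_rfl
      omega
    rw [Finset.sum_range, h.border_zero, Nat.sub_zero] at h1
    rw [← h1]
    refine Finset.sum_congr rfl fun v _ => ?_
    rw [hdeg v]
    omega
  rw [hsum, sum_degrees_eq_twice_card_edges, Set.ncard_eq_toFinset_card', edgeFinset]

/-- The invariant of the loop that writes down the sources of the arcs. -/
def SourcesInv (n : ℕ) (x : Fin n) (off adj : ℕ → ℕ) (s : State) : Prop :=
  (s.reg 0 = n ∧ s.reg 1 = x ∧ s.reg 2 = off n ∧ s.reg 3 = 0 ∧ s.reg 12 = 1 ∧ s.reg 13 = 2) ∧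
    (s.arr 0 = off ∧ s.arr 1 = adj ∧ (∀ j, s.arr 3 j = 0) ∧ ∀ j, s.arr 4 j = 0) ∧
    s.reg 5 ≤ n ∧ off (s.reg 5) ≤ s.reg 4 ∧ s.reg 4 ≤ off n ∧
    ∀ e < s.reg 4, ∃ u : Fin n, s.arr 2 e = u ∧ e ∈ Set.Ico (off u) (off ((u : ℕ) + 1))

theorem within_setup {s : State} (h : IsInput G x s) :
    Within setup s 5 fun t =>
      SourcesInv n x (s.arr 0) (s.arr 1) t ∧ t.reg 4 = 0 ∧ t.reg 5 = 0 := by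
  refine (Prog.within_of_wp _ ?_).mono (T := setup.cost) (by decide) fun _ h => h
  simp [setup, Prog.wp, Op.apply, State.setReg, SourcesInv, h.reg_zero, h.reg_one,
    h.reg_rest, h.arr_rest, h.border_zero]

theorem within_sources {s₀ s : State} (h : IsInput G x s₀)
    (hs : SourcesInv n x (s₀.arr 0) (s₀.arr 1) s) (h4 : s.reg 4 = 0) (h5 : s.reg 5 = 0) :
    Within (.loop (.lt 4 2) sourcesBody) s ((sourcesBody.cost + 1) * (s₀.arr 0 n + n) + 1) fun t =>
      Ready G x (s₀.arr 0 n) t ∧ (∀ j, t.arr 3 j = 0) ∧ ∀ j, t.arr 4 j = 0 := by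
  refine (Within.loop (c := sourcesBody.cost) (SourcesInv n x (s₀.arr 0) (s₀.arr 1))
    (fun t => (s₀.arr 0 n - t.reg 4) + (n - t.reg 5)) ?_ hs).mono (by simp [h4, h5]) ?_
  · rintro t ⟨⟨h0, h1, h2, h3, h12, h13⟩, ⟨ha0, ha1, ha3, ha4⟩, h5, ho, h4, hsr⟩ hlt
    have hlt : t.reg 4 < t.reg 2 := hlt
    rw [h2] at hlt
    -- At vertex index `n` the border would already be at most the arc counter, contradicting the
    -- loop test. Each iteration advances either the arc or the vertex, whence the measure.
    have h5n : t.reg 5 < n := by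
      refine lt_of_le_of_ne h5 fun h5n => ?_
      rw [h5n] at ho
      omega
    refine Prog.within_of_wp _ ?_
    simp only [sourcesBody, Prog.wp, Op.apply, Test.Holds, State.setReg, State.setArr, SourcesInv,
      h0, h1, h2, h3, h12, h13, ha0, ha1, ha3, ha4, Function.update_apply,
      Nat.reduceEqDiff, if_true, if_false, true_and, implies_true]
    refine ⟨fun hin => ⟨⟨h5, by omega, by omega, fun e he => ?_⟩, by omega⟩,
      fun hout => ⟨⟨by omega, by omega, h4, hsr⟩, by omega⟩⟩
    split_ifs with heq
    · exact ⟨⟨t.reg 5, h5n⟩, rfl, by rw [heq]; exact ⟨ho, hin⟩⟩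
    · exact hsr e (by omega)
  · rintro t ⟨⟨⟨h0, h1, h2, h3, h12, h13⟩, ⟨ha0, ha1, ha3, ha4⟩, h5, ho, h4, hsr⟩, hge⟩
    have hge : ¬ t.reg 4 < t.reg 2 := hge
    rw [h2] at hge
    refine ⟨⟨h0, h1, h2, h3, h12, h13, ?_⟩, ha3, ha4⟩
    rw [ha1]
    exact h.arcs fun e he => hsr e (by omega)

theorem within_rounds {M : ℕ} {s : State} (hI : RoundInv G x M s) (h11 : s.reg 11 = 1) :
    Within (.loop (.lt 3 11) roundBody) s ((100 * (n + M + 1) + 1) * (n + 1) + 1) fun t =>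
      RoundInv G x M t ∧ t.reg 11 = 0 := by
  refine (Within.loop (RoundInv G x M) (fun t => (live n (t.arr 4)).ncard + t.reg 11)
    (fun t ht hlt => within_round ht hlt) hI).mono ?_ ?_
  · rw [h11]
    have : (live n (s.arr 4)).ncard ≤ n := by
      simpa using Set.ncard_le_ncard (Set.subset_univ (live n (s.arr 4)))
    gcongr
  · rintro t ⟨ht, hle⟩
    have hle : ¬ t.reg 3 < t.reg 11 := hle
    have := ht.1.reg_three
    exact ⟨ht, by omega⟩

theorem within_extendableProg (h6 : (cycleGraph 6).Free G) (h7 : (cycleGraph 7).Free G)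
    {s : State} (h : IsInput G x s) :
    Within extendableProg s (400 * ((n + s.arr 0 n + 1) * (n + 1))) fun t =>
      (G.IsExtendable x → t.reg 0 = 1) ∧ (¬ G.IsExtendable x → t.reg 0 = 0) := by
  set M := s.arr 0 n with hM
  have hc1 : sourcesBody.cost ≤ 8 := by decide
  have hc2 : markBody.cost ≤ 8 := by decide
  have hc3 : secondBody.cost ≤ 20 := by decide
  have hc4 : pruneBody.cost ≤ 20 := by decide
  refine (Within.seq (T₂ := (sourcesBody.cost + 1) * (M + n) + 1 + ((markBody.cost + 2) * M + 2 +
    ((secondBody.cost + 2) * M + 2 + ((pruneBody.cost + 2) * M + 2 + (1 +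
    ((100 * (n + M + 1) + 1) * (n + 1) + 1 + 40 * (n + 1)))))))
    (within_setup h) ?_).mono ?_ fun _ h => h
  · rintro s₁ ⟨hs₁, h4, h5⟩
    refine Within.seq (within_sources h hs₁ h4 h5) ?_
    rintro s₂ ⟨hR, h3, h4⟩
    refine Within.seq (within_mark hR h3 h4) ?_
    rintro s₃ ⟨hR, h4, hA⟩
    refine Within.seq (within_second hR h4 hA) ?_
    rintro s₄ ⟨hR, hA, hC⟩
    refine Within.seq (within_prune h6 h7 hR hA hC) ?_
    rintro s₅ ⟨hR, hA, hC⟩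
    refine Within.seq (R := fun t => t = s₅.setReg 11 1) ⟨1, _, .op _ _, le_rfl, rfl⟩ ?_
    rintro t rfl
    have h11 : (s₅.setReg 11 1).reg 11 = 1 := by simp [State.setReg]
    refine Within.seq (within_rounds (M := M)
      ⟨hR.setReg (by decide), hA, hC, Or.inl h11⟩ h11) ?_
    rintro s₆ ⟨hI, h11⟩
    exact within_verdict h6 h7 hI h11
  · have e1 : (sourcesBody.cost + 1) * (M + n) ≤ 9 * (M + n) := by gcongr; omega
    have e2 : (markBody.cost + 2) * M ≤ 10 * M := by gcongr; omega
    have e3 : (secondBody.cost + 2) * M ≤ 22 * M := by gcongr; omega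
    have e4 : (pruneBody.cost + 2) * M ≤ 22 * M := by gcongr; omega
    nlinarith [Nat.zero_le (n * M), Nat.zero_le (n * n)]

end RAM

theorem mainTheorem1 :
    ∃ (P : RAM.Prog) (C : ℕ), ∀ (n : ℕ) (G : SimpleGraph (Fin n)) (x : Fin n),
      (SimpleGraph.cycleGraph 6).Free G → (SimpleGraph.cycleGraph 7).Free G →
      ∀ s : RAM.State, RAM.IsInput G x s →
        ∃ (t : ℕ) (s' : RAM.State), RAM.Exec P s t s' ∧
          t ≤ C * (n * (n + G.edgeSet.ncard)) ∧
          (G.IsExtendable x → s'.reg 0 = 1) ∧ (¬ G.IsExtendable x → s'.reg 0 = 0) := by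
  refine ⟨RAM.extendableProg, 1600, fun n G x h6 h7 s h => ?_⟩
  obtain ⟨t, s', hE, ht, hres⟩ := RAM.within_extendableProg h6 h7 h
  refine ⟨t, s', hE, ht.trans ?_, hres⟩
  -- The existence of `x` absorbs the additive constants: `n + 2m + 1 ≤ 2(n + m)` and `n + 1 ≤ 2n`,
  -- where `m` is the number of edges.
  have hn : 1 ≤ n := x.pos
  calc 400 * ((n + s.arr 0 n + 1) * (n + 1))
      ≤ 400 * ((2 * (n + G.edgeSet.ncard)) * (2 * n)) := by
        rw [h.border_eq]
        gcongr <;> omega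
    _ = 1600 * (n * (n + G.edgeSet.ncard)) := by ring
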